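/- Let $\Delta$ be a finite reduced (crystallographic) root system of rank $r$ in a real vector space $V$, with coroots $\alpha^\vee\in V^*$, fundamental system $\Psi=\{\alpha_1,\dots,\alpha_r\}$, positive roots $\Delta_+$, $\Delta_-=-\Delta_+$, coroot lattice $Q^\vee=\bigoplus_i\mathbb Z\alpha_i^\vee\subset V^*$ and fundamental weights $\lambda_i$ dual to the $\alpha_i^\vee$. For $\mathbf y\in V^*$ write $y_i=\langle\mathbf y,\lambda_i\rangle$. (If $V$ carries an $\mathrm{Aut}(\Delta)$-invariant inner product one may identify $V^*=V$.) The group $\mathrm{Aut}(\Delta)\subset GL(V)$ of automorphisms stabilizing $\Delta$ acts on $V^*$ contragrediently, so $w\alpha^\vee=(w\alpha)^\vee$; it acts on families $\mathbf k=(k_\alpha)\in\mathbb N_0^{\Delta/\pm1}$ by $(w\mathbf k)_\alpha=k_{w^{-1}\alpha}$. Put $\Delta_w=\Delta_+\cap w^{-1}\Delta_-$ and $\tau(q)\mathbf y=\mathbf y+q$. Let $\mathfrak D=\{\mathbf y: 0\le y_i\le 1\ (1\le i\le r)\}$, let $\mathfrak H$ be the union of all $q+\sum_{\beta\in\mathbf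 R}\mathbb R\beta^\vee$ with $q\in Q^\vee$ and $\mathbf R\subset\Delta$ linearly independent of cardinality $r-1$, and let $\mathfrak D^{(\nu)}$ ($\nu\in\mathfrak J$) be the connected components of $\mathfrak D\setminus\mathfrak H$. With $B_k(x)$ the classical Bernoulli polynomials and $\{x\}$ the fractional part, let $$P(\mathbf k,\mathbf y)=\int_{[0,1]^{\Delta_+\setminus\Psi}}\prod_{\alpha\in\Delta_+\setminus\Psi}B_{k_\alpha}(x_\alpha)\prod_{i=1}^rB_{k_{\alpha_i}}\Bigl(\Bigl\{y_i-\sum_{\alpha\in\Delta_+\setminus\Psi}x_\alpha\langle\alpha^\vee,\lambda_i\rangle\Bigr\}\Bigr)\prod_{\alpha\in\Delta_+\setminus\Psi} dx_\alpha .$$ **Theorem.** (0) For all $\mathbf k,\nu$ there is a unique $B^{(\nu)}_{\mathbf k}\in\mathbb Q[y_1,\dots,y_r]$ that agrees with $P(\mathbf k,\cdot)$ on $\mathfrak D^{(\nu)}$. (1) For all $w\in\mathrm{Aut}(\Delta)$, $\nu\in\mathfrak J$ there are unique $q_{w,\nu}\in Q^\vee$ and $w(\nu)\in\mathfrak J$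 with $\tau(q_{w,\nu})w\mathfrak D^{(\nu)}=\mathfrak D^{(w(\nu))}$. This defines an action of $\mathrm{Aut}(\Delta)$ on $\mathfrak J$, and $q_{v,w(\nu)}+v\,q_{w,\nu}=q_{vw,\nu}$. (2) For all $w,\mathbf k,\nu$ and all $\mathbf y\in\mathbb C\otimes V^*$, $$B^{(\nu)}_{\mathbf k}(\tau(q_{w^{-1},w(\nu)})w^{-1}\mathbf y)=\Bigl(\prod_{\alpha\in\Delta_w}(-1)^{-k_\alpha}\Bigr)B^{(w(\nu))}_{w\mathbf k}(\mathbf y).$$ (3) Let $\mathfrak P$ be the $\mathbb Q$-vector space of all $f=(f_\nu)_{\nu\in\mathfrak J}:V^*\to\mathbb R^{\mathfrak J}$ with every $f_\nu\in\mathbb Q[y_1,\dots,y_r]$. Then $(\phi(w)f)_\nu(\mathbf y)=f_{w^{-1}(\nu)}(\tau(q_{w^{-1},\nu})w^{-1}\mathbf y)$ defines a representation $\phi$ of $\mathrm{Aut}(\Delta)$ on $\mathfrak P$. (4) Let $\mathbf B^{(\nu)}_{\mathbf k}\in\mathfrak P$ have component $B^{(\nu)}_{\mathbf k}$ at $\nu$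 and $0$ at every other index. Then $$\phi(w)\mathbf B^{(\nu)}_{\mathbf k}=\Bigl(\prod_{\alpha\in\Delta_w}(-1)^{-k_\alpha}\Bigr)\mathbf B^{(w(\nu))}_{w\mathbf k}.$$ For every $\mathrm{Aut}(\Delta)$-orbit in $\mathbb N_0^{\Delta/\pm1}\times\mathfrak J$, the $\mathbb Q$-span of the $\mathbf B^{(\nu)}_{\mathbf k}$ with $(\mathbf k,\nu)$ in the orbit is a finite-dimensional $\mathrm{Aut}(\Delta)$-invariant subspace of $\mathfrak P$. (5) If $r=1$ (type $A_1$, simple root $\alpha$, reflection $\sigma$), then $B^{(\nu)}_{\mathbf k}(\mathbf y)=B_{k_\alpha}(y_1)$ and $(\phi(\sigma)f)_\nu(\mathbf y)=f_\nu(\alpha^\vee-\mathbf y)$, so (4) for $w=\sigma$ is the classical formula $B_k(1-y)=(-1)^kB_k(y)$. -/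

import Mathlib

open scoped TensorProduct

noncomputable section

namespace RootBernoulli

/-- The exponents `k = (k_α)`, indexed by the roots modulo sign, with values in the natural
numbers: a family on the quotient of the set of roots by `±1` is the same thing as an even family
on the roots. -/
def Exponent {ι M N : Type*} [AddCommGroup M] [Module ℝ M] [AddCommGroup N] [Module ℝ N]
    (P : RootPairing ι ℝ M N) : Type _ :=
  {k : ι → ℕ // ∀ i j, P.root j = -P.root i → k j = k i}

section

variable {ι M N : Type*} [AddCommGroup M] [Module ℝ M] [AddCommGroup N] [Module ℝ N]
  {P : RootPairing ι ℝ M N}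

/-- The action `(w k)_α = k_{w⁻¹ α}` of the automorphism group on exponents. -/
instance : MulAction P.Aut (Exponent P) where
  smul w k := ⟨fun i => k.1 (w⁻¹ • i), fun i j h => k.2 _ _ (by
    have key : ∀ (v : P.Aut) (l : ι), P.root (v • l) = v • P.root l := fun v l =>
      (RootPairing.Hom.root_weightMap_apply P P l v.toHom).symm
    rw [key, key, h, smul_neg])⟩
  one_smul k := Subtype.ext (funext fun i => by
    change k.1 ((1 : P.Aut)⁻¹ • i) = k.1 i
    rw [inv_one, one_smul])
  mul_smul v w k := Subtype.ext (funext fun i => by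
    change k.1 ((v * w)⁻¹ • i) = k.1 (w⁻¹ • v⁻¹ • i)
    rw [mul_inv_rev, mul_smul])

/-- The action of an automorphism `w` of the root system on the space `N` containing the coroots:
the contragredient of its action on the space `M` containing the roots. It sends the coroot of `α`
to the coroot of `w α`. -/
def act (w : P.Aut) : N ≃ₗ[ℝ] N := (RootPairing.Equiv.coweightEquiv P P w).symm

variable (b : P.Base)

/-- The coroot lattice `⨁ ℤ αᵢ^∨` (`αᵢ` simple). -/
def corootLattice : Submodule ℤ N := Submodule.span ℤ (P.coroot '' b.support)

/-- The arrangement: the union of all `q + span_ℝ {β^∨ : β ∈ R}` where `q` is in the coroot lattice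
and `R` is a linearly independent set of `r - 1` roots, `r` being the rank. -/
def arrangement : Set N :=
  {y | ∃ R : Finset ι, LinearIndepOn ℝ P.root (R : Set ι) ∧ R.card + 1 = b.support.card ∧
    ∃ q ∈ corootLattice b, y - q ∈ Submodule.span ℝ (P.coroot '' (R : Set ι))}

/-- The sign `∏_{α ∈ Δ_w} (-1)^(-k_α)`, where `Δ_w` is the set of positive roots that `w` makes
negative. -/
def sign [Fintype ι] (w : P.Aut) (k : Exponent P) : ℚ :=
  open scoped Classical in
  ∏ i : {i : ι // b.IsPos i ∧ ¬ b.IsPos (w • i)}, (-1 : ℚ) ^ (-(k.1 i.1 : ℤ))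

variable [P.IsRootSystem]

/-- The coordinates `yᵢ = ⟨y, λᵢ⟩`. The fundamental weights `λᵢ` are the basis dual to the simple
coroots, so these are the coordinates of `y` in the basis of simple coroots. -/
def coord (y : N) (i : b.support) : ℝ := b.toCoweightBasis.repr y i

/-- The coordinates `yᵢ` on the complexification, extended complex linearly. -/
def coordC (y : ℂ ⊗[ℝ] N) (i : b.support) : ℂ := (b.toCoweightBasis.baseChange ℂ).repr y i

/-- The closed period parallelotope `0 ≤ ⟨y, λᵢ⟩ ≤ 1`. -/
def parallelotope : Set N := {y | ∀ i, 0 ≤ coord b y i ∧ coord b y i ≤ 1}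

/-- The index set of the connected components `𝔇^(ν)` of the parallelotope minus the arrangement;
an index is the component itself. -/
def Cell [TopologicalSpace N] : Type _ :=
  {D : Set N // ∃ y ∈ parallelotope b \ arrangement b,
    D = connectedComponentIn (parallelotope b \ arrangement b) y}

/-- The periodic function `P(k, y; Δ)`: the integral over the cube `0 ≤ x_α ≤ 1`, `α` ranging over
the positive roots that are not simple, of `∏ B_{k_α}(x_α)` times
`∏_i B_{k_{αᵢ}}({⟨y, λᵢ⟩ - ∑ x_α ⟨α^∨, λᵢ⟩})`. -/
def periodic [Fintype ι] (k : Exponent P) (y : N) : ℝ :=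
  open scoped Classical in
  ∫ x : {i : ι // b.IsPos i ∧ i ∉ b.support} → ℝ in Set.Icc 0 1,
    (∏ a, bernoulliFun (k.1 a.1) (x a)) *
      ∏ i : b.support, bernoulliFun (k.1 i.1)
        (Int.fract (coord b y i - ∑ a, x a * coord b (P.coroot a.1) i))

/-- `p` is a rational polynomial in the coordinates `yᵢ` which continues `P(k, y; Δ)` from the
component `𝔇^(ν)`. -/
def Continues [Fintype ι] [TopologicalSpace N] (k : Exponent P) (ν : Cell b)
    (p : MvPolynomial b.support ℚ) : Prop :=
  ∀ y ∈ ν.1, MvPolynomial.aeval (coord b y) p = periodic b k y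

/-- The polynomial `B_k^(ν)`: the rational polynomial continuing `P(k, y; Δ)` from `𝔇^(ν)`. -/
def bernoulliPoly [Fintype ι] [TopologicalSpace N] (k : Exponent P) (ν : Cell b) :
    MvPolynomial b.support ℚ :=
  Classical.epsilon (Continues b k ν)

/-- The `ℚ`-vector space of vector-valued polynomial functions `f = (f_ν)` on `N` all of whose
components are polynomials in the `yᵢ` with rational coefficients. -/
def polySpace [TopologicalSpace N] : Submodule ℚ (N → Cell b → ℝ) where
  carrier := {f | ∀ ν, ∃ p : MvPolynomial b.support ℚ,
    ∀ y, f y ν = MvPolynomial.aeval (coord b y) p}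
  add_mem' := fun hf hg ν => by
    obtain ⟨p, hp⟩ := hf ν
    obtain ⟨p', hp'⟩ := hg ν
    exact ⟨p + p', fun y => by simp [hp, hp']⟩
  zero_mem' := fun ν => ⟨0, fun y => by simp⟩
  smul_mem' := fun c f hf ν => by
    obtain ⟨p, hp⟩ := hf ν
    exact ⟨c • p, fun y => by simp [hp]⟩

/-- The vector-valued polynomial with `B_k^(ν)` in position `ν` and `0` elsewhere. -/
def vecB [Fintype ι] [TopologicalSpace N] (k : Exponent P) (ν : Cell b) : polySpace b :=
  open scoped Classical in
  ⟨fun y κ => if κ = ν then MvPolynomial.aeval (coord b y) (bernoulliPoly b k ν) else 0,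
    fun κ => ⟨if κ = ν then bernoulliPoly b k ν else 0, fun y => by
      by_cases h : κ = ν <;> simp [h]⟩⟩

/-- The `ℚ`-span of the vectors `vecB k' ν'`, `(k', ν')` running over an orbit of the automorphism
group on pairs (exponent, component). -/
def orbitSpan [Fintype ι] [TopologicalSpace N] [MulAction P.Aut (Cell b)]
    (o : MulAction.orbitRel.Quotient P.Aut (Exponent P × Cell b)) : Submodule ℚ (polySpace b) :=
  Submodule.span ℚ ((fun p : Exponent P × Cell b => vecB b p.1 p.2) '' o.orbit)

end

end RootBernoulli

end

open RootBernoulli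

/-! The function `periodic b k` is periodic under the coroot lattice, hence lives on a torus, and it
is a convolution of Bernoulli functions. Its Fourier coefficient at `m` is therefore a product over
all positive roots `α` of Bernoulli Fourier coefficients of index `k_α` at `⟨α^∨, m⟩`
(`mFourierCoeff_torusPeriodic`). Everything analytic is read off from this product.

Piecewise polynomiality: multiplication by `2πi ⟨α^∨, m⟩` lowers the index of one factor, so linear
relations among coroots rewrite the product as a rational combination of products along bases
(`coef_mem_basisSpan`). For a basis, an explicit function has these coefficients: an average over
torsion points of Bernoulli functions in the dual coordinates. It jumps only where such a coordinate
is an integer, which happens only on the arrangement (`exists_function_of_basis`). Functions with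
equal Fourier coefficients agree almost everywhere, and both sides are continuous on the open cells,
so they agree there (`exists_continues`).

Symmetry: an automorphism permutes the positive roots up to sign, and each sign change costs
`(-1)^{k_α}` by the parity of the Bernoulli coefficients (`coef_smul`). This gives the
transformation law almost everywhere, then on the cells, and then as an identity of polynomials
(`substPoly_bernoulliPoly`), valid at complex points as well.

Action on cells: the hyperplanes where some `y_i` is an integer belong to the arrangement, so the
image of a cell lies in a single lattice translate of the parallelotope. Exactly one translation
brings it back, and this uniqueness yields both the action laws and the cocycle identity, which in
turn make `polyRep` a representation. -/

noncomputable section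

set_option linter.unusedSectionVars false

namespace RootBernoulli

open MeasureTheory UnitAddTorus

attribute [local instance] instMeasureSpaceUnitAddCircle

local instance : Measure.IsAddHaarMeasure (volume : Measure UnitAddCircle) :=
  inferInstanceAs (Measure.IsAddHaarMeasure AddCircle.haarAddCircle)

local instance : IsProbabilityMeasure (volume : Measure UnitAddCircle) :=
  inferInstanceAs (IsProbabilityMeasure AddCircle.haarAddCircle)

/-! ### Fourier analysis on tori and maps given by integer matrices. -/

section Torus

variable {d e : Type*} [Fintype d] [Fintype e]

/-- The group homomorphism between tori given by an integer matrix. -/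
def torusMap (A : Matrix e d ℤ) : UnitAddTorus d →+ UnitAddTorus e where
  toFun Y j := ∑ i, A j i • Y i
  map_zero' := by ext; simp
  map_add' Y Z := by ext; simp [smul_add, Finset.sum_add_distrib]

lemma torusMap_apply (A : Matrix e d ℤ) (Y : UnitAddTorus d) (j : e) :
    torusMap A Y j = ∑ i, A j i • Y i := rfl

@[fun_prop]
lemma continuous_torusMap (A : Matrix e d ℤ) : Continuous (torusMap A) :=
  continuous_pi fun j => continuous_finsetSum _ fun i _ =>
    (continuous_zsmul (A j i)).comp (continuous_apply i)

/-- A function on a torus that is measurable and bounded. -/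
def BddMeas (f : UnitAddTorus d → ℝ) : Prop :=
  Measurable f ∧ ∃ C, ∀ x, |f x| ≤ C

lemma mFourier_eq_toCircle (n : d → ℤ) (Y : UnitAddTorus d) :
    mFourier n Y = (AddCircle.toCircle (∑ i, n i • Y i) : ℂ) := by
  classical
  have h : ∀ s : Finset d, (AddCircle.toCircle (∑ i ∈ s, n i • Y i) : ℂ) =
      ∏ i ∈ s, fourier (n i) (Y i) := by
    intro s
    induction s using Finset.induction_on with
    | empty => simp
    | insert a s ha ih =>
      rw [Finset.sum_insert ha, Finset.prod_insert ha, AddCircle.toCircle_add, Circle.coe_mul, ih,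
        fourier_apply]
  exact (h _).symm

lemma mFourier_apply_add (n : d → ℤ) (Y Z : UnitAddTorus d) :
    mFourier n (Y + Z) = mFourier n Y * mFourier n Z := by
  simp [mFourier_eq_toCircle, smul_add, Finset.sum_add_distrib, AddCircle.toCircle_add]

lemma mFourier_torusMap (A : Matrix e d ℤ) (n : e → ℤ) (Y : UnitAddTorus d) :
    mFourier n (torusMap A Y) = mFourier (Matrix.vecMul n A) Y := by
  simp only [mFourier_eq_toCircle, torusMap_apply, Matrix.vecMul, dotProduct, Finset.smul_sum,
    Finset.sum_smul, mul_smul]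
  rw [Finset.sum_comm]

lemma BddMeas.memLp {f : UnitAddTorus d → ℝ} (hf : BddMeas f) :
    MemLp (fun x => (f x : ℂ)) 2 := by
  obtain ⟨hm, C, hC⟩ := hf
  exact MemLp.of_bound (Complex.measurable_ofReal.comp hm).aestronglyMeasurable C
    (.of_forall fun x => by simpa using hC x)

/-- Bounded measurable functions with the same Fourier coefficients agree almost everywhere. -/
lemma BddMeas.ae_eq {f g : UnitAddTorus d → ℝ} (hf : BddMeas f) (hg : BddMeas g)
    (h : ∀ n, mFourierCoeff (fun x => (f x : ℂ)) n = mFourierCoeff (fun x => (g x : ℂ)) n) :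
    f =ᵐ[volume] g := by
  have key : ∀ {u : UnitAddTorus d → ℂ} (hu : MemLp u 2) (n : d → ℤ),
      mFourierBasis.repr (hu.toLp u) n = mFourierCoeff u n := by
    intro u hu n
    rw [mFourierBasis_repr]
    refine integral_congr_ae ?_
    filter_upwards [hu.coeFn_toLp] with x hx
    rw [hx]
  have h1 : hf.memLp.toLp _ = hg.memLp.toLp _ := by
    apply mFourierBasis.repr.injective
    ext n
    rw [key hf.memLp, key hg.memLp, h]
  have h2 := (MemLp.toLp_eq_toLp_iff hf.memLp hg.memLp).1 h1
  filter_upwards [h2] with x hx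
  exact_mod_cast hx

lemma measurePreserving_torus {f : UnitAddTorus d →+ UnitAddTorus e} (hc : Continuous f)
    (hs : Function.Surjective f) : MeasurePreserving f :=
  AddMonoidHom.measurePreserving hc hs (by simp)

lemma torusMap_torusMap {c : Type*} [Fintype c] (B : Matrix c e ℤ) (A : Matrix e d ℤ)
    (Y : UnitAddTorus d) : torusMap B (torusMap A Y) = torusMap (B * A) Y := by
  ext j
  simp only [torusMap_apply, Matrix.mul_apply, Finset.smul_sum, Finset.sum_smul, mul_smul]
  rw [Finset.sum_comm]

lemma torusMap_smul_one [DecidableEq d] (D : ℤ) (Y : UnitAddTorus d) :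
    torusMap (D • (1 : Matrix d d ℤ)) Y = D • Y := by
  ext j
  simp only [torusMap_apply, Matrix.smul_apply, Matrix.one_apply, smul_eq_mul, mul_ite, mul_one,
    mul_zero, ite_smul, zero_smul, Finset.sum_ite_eq, Finset.mem_univ, if_true, Pi.smul_apply]

lemma zsmul_torus_surjective {D : ℤ} (hD : D ≠ 0) :
    Function.Surjective (fun Y : UnitAddTorus d => D • Y) := fun Y =>
  ⟨fun i => DivisibleBy.div (Y i) D, funext fun i => DivisibleBy.div_cancel (Y i) hD⟩

lemma torusMap_surjective [DecidableEq e] {A : Matrix e d ℤ} {B : Matrix d e ℤ} {D : ℤ}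
    (hD : D ≠ 0) (h : A * B = D • (1 : Matrix e e ℤ)) : Function.Surjective (torusMap A) := by
  intro Z
  obtain ⟨Y, hY⟩ := zsmul_torus_surjective hD Z
  exact ⟨torusMap B Y, by rw [torusMap_torusMap, h, torusMap_smul_one]; exact hY⟩

lemma integral_comp_torus {f : UnitAddTorus d →+ UnitAddTorus e} (hc : Continuous f)
    (hs : Function.Surjective f) {F : UnitAddTorus e → ℂ} (hF : Measurable F) :
    ∫ Y, F (f Y) = ∫ X, F X := by
  rw [← (measurePreserving_torus hc hs).map_eq]
  exact (integral_map hc.measurable.aemeasurable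
    (by rw [(measurePreserving_torus hc hs).map_eq]; exact hF.aestronglyMeasurable)).symm

lemma BddMeas.add {f g : UnitAddTorus d → ℝ} (hf : BddMeas f) (hg : BddMeas g) :
    BddMeas (fun x => f x + g x) := by
  obtain ⟨hm, C, hC⟩ := hf
  obtain ⟨hm', C', hC'⟩ := hg
  exact ⟨hm.add hm', C + C', fun x => (abs_add_le _ _).trans (add_le_add (hC x) (hC' x))⟩

lemma BddMeas.const_mul {f : UnitAddTorus d → ℝ} (hf : BddMeas f) (c : ℝ) :
    BddMeas (fun x => c * f x) := by
  obtain ⟨hm, C, hC⟩ := hf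
  exact ⟨hm.const_mul c, |c| * C, fun x => by
    rw [abs_mul]; exact mul_le_mul_of_nonneg_left (hC x) (abs_nonneg c)⟩

lemma BddMeas.sum {κ : Type*} (s : Finset κ) {f : κ → UnitAddTorus d → ℝ}
    (hf : ∀ j ∈ s, BddMeas (f j)) : BddMeas (fun x => ∑ j ∈ s, f j x) := by
  classical
  induction s using Finset.induction_on with
  | empty => exact ⟨by simp, 0, by simp⟩
  | insert a s ha ih =>
    simp only [Finset.sum_insert ha]
    exact (hf a (by simp)).add (ih fun j hj => hf j (by simp [hj]))

lemma BddMeas.prod {κ : Type*} (s : Finset κ) {f : κ → UnitAddTorus d → ℝ}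
    (hf : ∀ j ∈ s, BddMeas (f j)) : BddMeas (fun x => ∏ j ∈ s, f j x) := by
  classical
  induction s using Finset.induction_on with
  | empty => exact ⟨by simp, 1, by simp⟩
  | insert a s ha ih =>
    simp only [Finset.prod_insert ha]
    obtain ⟨hm, C, hC⟩ := hf a (by simp)
    obtain ⟨hm', C', hC'⟩ := ih fun j hj => hf j (by simp [hj])
    refine ⟨hm.mul hm', C * C', fun x => ?_⟩
    rw [abs_mul]
    exact mul_le_mul (hC x) (hC' x) (abs_nonneg _) ((abs_nonneg _).trans (hC x))

lemma BddMeas.comp {f : UnitAddTorus e → ℝ} (hf : BddMeas f) {g : UnitAddTorus d → UnitAddTorus e}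
    (hg : Measurable g) : BddMeas (fun x => f (g x)) := by
  obtain ⟨hm, C, hC⟩ := hf
  exact ⟨hm.comp hg, C, fun x => hC _⟩

lemma mFourierCoeff_add {f g : UnitAddTorus d → ℝ} (hf : BddMeas f) (hg : BddMeas g) (n : d → ℤ) :
    mFourierCoeff (fun x => ((f x + g x : ℝ) : ℂ)) n =
      mFourierCoeff (fun x => (f x : ℂ)) n + mFourierCoeff (fun x => (g x : ℂ)) n := by
  have key : ∀ {u : UnitAddTorus d → ℝ}, BddMeas u →
      Integrable (fun x => mFourier (-n) x • (u x : ℂ)) := by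
    rintro u ⟨hm, C, hC⟩
    refine Integrable.of_bound ((mFourier (-n)).continuous.measurable.smul
      (Complex.measurable_ofReal.comp hm)).aestronglyMeasurable C (.of_forall fun x => ?_)
    rw [norm_smul, mFourier_eq_toCircle, Circle.norm_coe, one_mul]
    simpa using hC x
  simp only [mFourierCoeff]
  rw [← integral_add (key hf) (key hg)]
  simp [mul_add]

lemma mFourierCoeff_const_mul (f : UnitAddTorus d → ℝ) (c : ℝ) (n : d → ℤ) :
    mFourierCoeff (fun x => ((c * f x : ℝ) : ℂ)) n =
      c * mFourierCoeff (fun x => (f x : ℂ)) n := by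
  simp only [mFourierCoeff]
  rw [← integral_const_mul]
  congr 1
  ext x
  simp only [smul_eq_mul, Complex.ofReal_mul]
  ring

end Torus

/-! ### Periodized Bernoulli functions and their Fourier coefficients. -/

section Bernoulli

lemma periodizedBernoulli_coe (k : ℕ) (x : ℝ) :
    periodizedBernoulli k (x : UnitAddCircle) = bernoulliFun k (Int.fract x) := by
  have h : (x : UnitAddCircle) = (Int.fract x : ℝ) := by
    rw [← sub_eq_zero, ← AddCircle.coe_sub, Int.self_sub_fract, AddCircle.coe_eq_zero_iff]
    exact ⟨⌊x⌋, by simp⟩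
  rw [h]
  exact AddCircle.liftIco_zero_coe_apply ⟨Int.fract_nonneg x, Int.fract_lt_one x⟩

lemma measurable_periodizedBernoulli (k : ℕ) : Measurable (periodizedBernoulli k) :=
  ((Polynomial.continuous _ : Continuous (bernoulliFun k)).measurable.comp
    measurable_subtype_coe).comp (AddCircle.measurableEquivIco 1 0).measurable

lemma exists_abs_periodizedBernoulli_le (k : ℕ) :
    ∃ C, ∀ x : UnitAddCircle, |periodizedBernoulli k x| ≤ C := by
  obtain ⟨C, hC⟩ := isCompact_Icc.exists_bound_of_continuousOn
    (continuous_bernoulliFun k).continuousOn (s := Set.Icc 0 1)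
  refine ⟨C, fun x => ?_⟩
  induction x using QuotientAddGroup.induction_on with
  | H x =>
    exact (congrArg abs (periodizedBernoulli_coe k x)).trans_le
      (hC _ ⟨Int.fract_nonneg x, (Int.fract_lt_one x).le⟩)

lemma continuousAt_periodizedBernoulli (k : ℕ) {x : UnitAddCircle} (hx : x ≠ 0) :
    ContinuousAt (periodizedBernoulli k) x := by
  have h : ContinuousAt (AddCircle.equivIco (1 : ℝ) 0) x :=
    AddCircle.continuousAt_equivIco 1 0 (by simpa using hx)
  exact ((continuous_bernoulliFun k).continuousAt.comp
    continuous_subtype_val.continuousAt).comp h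

lemma fourierCoeff_periodizedBernoulli (k : ℕ) (n : ℤ) :
    fourierCoeff (fun x => (periodizedBernoulli k x : ℂ)) n = bernoulliFourierCoeff k n := by
  have : (fun x => (periodizedBernoulli k x : ℂ)) =
      AddCircle.liftIco 1 0 (fun x => (bernoulliFun k x : ℂ)) := rfl
  rw [this, fourierCoeff_liftIco_eq]
  simp only [zero_add]
  rfl

/-- On the Fourier side the parity of `B_k({x})` has no exception, although pointwise it fails at `x
= 0` for `k = 1`. -/
lemma bernoulliFourierCoeff_neg (k : ℕ) (n : ℤ) :
    bernoulliFourierCoeff k (-n) = (-1) ^ k * bernoulliFourierCoeff k n := by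
  rcases eq_or_ne k 0 with rfl | hk
  · rcases eq_or_ne n 0 with rfl | hn
    · simp
    · simp [bernoulli_zero_fourier_coeff hn, bernoulli_zero_fourier_coeff (neg_ne_zero.2 hn)]
  · rw [bernoulliFourierCoeff_eq hk, bernoulliFourierCoeff_eq hk]
    push_cast
    rw [mul_neg, neg_pow, div_mul_eq_div_div, div_eq_mul_inv _ ((-1 : ℂ) ^ k), ← inv_pow, inv_neg,
      inv_one]
    ring

lemma bernoulliFourierCoeff_zero_zero : bernoulliFourierCoeff 0 0 = 1 := by
  simp [bernoulliFourierCoeff, fourierCoeffOn_eq_integral]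

/-- Multiplication by `2πi n` lowers the index of the Bernoulli Fourier coefficients. -/
lemma mul_bernoulliFourierCoeff_succ (k : ℕ) (n : ℤ) :
    -- This is `B_{k+1}' = (k+1) B_k` for periodic distributions; the extra `1` for `k = 0` is the
    -- Dirac mass at the jump of `B_1({x})`.
    2 * Real.pi * Complex.I * n * bernoulliFourierCoeff (k + 1) n =
      (k + 1) * bernoulliFourierCoeff k n - if k = 0 then 1 else 0 := by
  rcases eq_or_ne n 0 with rfl | hn
  · rcases eq_or_ne k 0 with rfl | hk
    · simp [bernoulliFourierCoeff_zero_zero]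
    · simp [hk, bernoulliFourierCoeff_zero hk]
  · rw [bernoulliFourierCoeff_recurrence (k + 1) hn]
    have : (2 * Real.pi * Complex.I * n : ℂ) ≠ 0 := by
      simp [Real.pi_ne_zero, Complex.I_ne_zero, hn]
    have h2 : (n : ℂ) ≠ 0 := by exact_mod_cast hn
    have h3 : (Real.pi : ℂ) ≠ 0 := by exact_mod_cast Real.pi_ne_zero
    simp only [Nat.add_sub_cancel, Nat.add_eq_right]
    push_cast
    field_simp
    ring

end Bernoulli

/-! ### Convolutions of Bernoulli functions: Fourier coefficients, continuity, passage to the cube.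
-/

section Convolution

variable {d e : Type*} [Fintype d] [Fintype e]

lemma mFourierCoeff_prod (f : d → UnitAddCircle → ℝ) (m : d → ℤ) :
    mFourierCoeff (fun Y : UnitAddTorus d => ((∏ i, f i (Y i) : ℝ) : ℂ)) m =
      ∏ i, fourierCoeff (fun x => (f i x : ℂ)) (m i) := by
  simp only [mFourierCoeff, fourierCoeff]
  refine Eq.trans ?_ (integral_fintype_prod_volume_eq_prod
    (fun i (x : UnitAddCircle) => fourier (-(m i)) x • (f i x : ℂ)))
  congr 1
  ext Y
  simp only [mFourier, ContinuousMap.coe_mk, Pi.neg_apply, Complex.ofReal_prod, smul_eq_mul,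
    Finset.prod_mul_distrib]

/-- The product of periodized Bernoulli polynomials in the coordinates of a torus. -/
def prodBernoulli (k : d → ℕ) (Y : UnitAddTorus d) : ℝ := ∏ i, periodizedBernoulli (k i) (Y i)

lemma bddMeas_prodBernoulli (k : d → ℕ) : BddMeas (prodBernoulli k) :=
  BddMeas.prod _ fun i _ => ⟨(measurable_periodizedBernoulli (k i)).comp (measurable_pi_apply i),
    (exists_abs_periodizedBernoulli_le (k i)).imp fun _ h x => h (x i)⟩

lemma mFourierCoeff_prodBernoulli (k : d → ℕ) (m : d → ℤ) :
    mFourierCoeff (fun Y => (prodBernoulli k Y : ℂ)) m =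
      ∏ i, bernoulliFourierCoeff (k i) (m i) := by
  simp only [← fourierCoeff_periodizedBernoulli]
  exact mFourierCoeff_prod (fun i => periodizedBernoulli (k i)) m

/-- The push-forward of a product of periodized Bernoulli polynomials under the addition map
`(X, Y) ↦ Y + A X` of tori, as a density. -/
def convBernoulli (A : Matrix d e ℤ) (k : e → ℕ) (l : d → ℕ) (Y : UnitAddTorus d) : ℝ :=
  ∫ X : UnitAddTorus e, prodBernoulli k X * prodBernoulli l (Y - torusMap A X)

lemma measurable_convBernoulli_integrand (A : Matrix d e ℤ) (k : e → ℕ) (l : d → ℕ) :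
    Measurable fun p : UnitAddTorus d × UnitAddTorus e =>
      prodBernoulli k p.2 * prodBernoulli l (p.1 - torusMap A p.2) :=
  ((bddMeas_prodBernoulli k).1.comp measurable_snd).mul ((bddMeas_prodBernoulli l).1.comp
    (continuous_fst.sub ((continuous_torusMap A).comp continuous_snd)).measurable)

lemma exists_abs_convBernoulli_integrand_le (A : Matrix d e ℤ) (k : e → ℕ) (l : d → ℕ) :
    ∃ C, ∀ Y X, |prodBernoulli k X * prodBernoulli l (Y - torusMap A X)| ≤ C := by
  obtain ⟨-, C, hC⟩ := bddMeas_prodBernoulli k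
  obtain ⟨-, C', hC'⟩ := bddMeas_prodBernoulli l
  refine ⟨C * C', fun Y X => ?_⟩
  rw [abs_mul]
  exact mul_le_mul (hC _) (hC' _) (abs_nonneg _) ((abs_nonneg _).trans (hC X))

lemma bddMeas_convBernoulli (A : Matrix d e ℤ) (k : e → ℕ) (l : d → ℕ) :
    BddMeas (convBernoulli A k l) := by
  refine ⟨((measurable_convBernoulli_integrand A k l).stronglyMeasurable.integral_prod_right
    (ν := volume)).measurable, ?_⟩
  obtain ⟨C, hC⟩ := exists_abs_convBernoulli_integrand_le A k l
  refine ⟨C, fun Y => ?_⟩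
  have := norm_integral_le_of_norm_le_const (μ := (volume : Measure (UnitAddTorus e)))
    (f := fun X => prodBernoulli k X * prodBernoulli l (Y - torusMap A X)) (C := C)
    (.of_forall fun X => hC Y X)
  simpa [convBernoulli] using this

lemma norm_mFourier_apply (n : d → ℤ) (Y : UnitAddTorus d) : ‖mFourier n Y‖ = 1 := by
  rw [mFourier_eq_toCircle, Circle.norm_coe]

/-- Fubini and the translation `Y ↦ Y - A X` separate the variables; the character of `A X` left
over is the character `m A` of `X`. -/
lemma mFourierCoeff_convBernoulli (A : Matrix d e ℤ) (k : e → ℕ) (l : d → ℕ) (m : d → ℤ) :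
    mFourierCoeff (fun Y => (convBernoulli A k l Y : ℂ)) m =
      (∏ j, bernoulliFourierCoeff (k j) (Matrix.vecMul m A j)) *
        ∏ i, bernoulliFourierCoeff (l i) (m i) := by
  rw [← mFourierCoeff_prodBernoulli, ← mFourierCoeff_prodBernoulli]
  simp only [mFourierCoeff, convBernoulli, ← integral_complex_ofReal, smul_eq_mul]
  rw [← integral_mul_const]
  simp only [← integral_const_mul]
  rw [integral_integral_swap]
  · congr 1
    ext X
    rw [integral_const_mul, ← integral_sub_right_eq_self
      (fun Y => mFourier (-m) Y * (prodBernoulli l Y : ℂ)) (torusMap A X), ← integral_const_mul]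
    congr 1
    ext Y
    have : mFourier (-m) Y = mFourier (-m) (Y - torusMap A X) *
        mFourier (-Matrix.vecMul m A) X := by
      rw [← Matrix.neg_vecMul, ← mFourier_torusMap, ← mFourier_apply_add, sub_add_cancel]
    rw [this]
    push_cast
    ring
  · obtain ⟨C, hC⟩ := exists_abs_convBernoulli_integrand_le A k l
    refine Integrable.of_bound (Measurable.aestronglyMeasurable ?_) C (.of_forall ?_)
    · exact ((mFourier (-m)).continuous.measurable.comp measurable_fst).mul
        (Complex.measurable_ofReal.comp (measurable_convBernoulli_integrand A k l))
    · rintro ⟨Y, X⟩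
      simp only [Function.uncurry_apply_pair, norm_mul, norm_mFourier_apply, one_mul]
      rw [Complex.norm_real]
      exact hC Y X

/-- A nonzero row is a surjective character, so it carries Haar measure to Haar measure, for which
points are null. -/
lemma ae_torusMap_ne (A : Matrix d e ℤ) {i : d} {j : e} (h : A i j ≠ 0) (c : UnitAddCircle) :
    ∀ᵐ X : UnitAddTorus e, torusMap A X i ≠ c := by
  classical
  let χ : UnitAddTorus e →+ UnitAddCircle := (Pi.evalAddMonoidHom _ i).comp (torusMap A)
  have hc : Continuous χ := (continuous_apply i).comp (continuous_torusMap A)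
  have hs : Function.Surjective χ := fun z => ⟨Pi.single j (DivisibleBy.div z (A i j)), by
    change torusMap A _ i = z
    rw [torusMap_apply, Finset.sum_eq_single j]
    · rw [Pi.single_eq_same, DivisibleBy.div_cancel z h]
    · intro b _ hb
      rw [Pi.single_eq_of_ne hb, smul_zero]
    · simp⟩
  have hp : MeasurePreserving χ := AddMonoidHom.measurePreserving hc hs (by simp)
  have : volume (χ ⁻¹' {c}) = 0 := by
    rw [hp.measure_preimage (measurableSet_singleton c).nullMeasurableSet]
    have h1 := AddCircle.volume_closedBall (T := 1) (x := c) 0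
    rw [Metric.closedBall_zero, mul_zero, min_eq_right zero_le_one, ENNReal.ofReal_zero,
      AddCircle.volume_eq_smul_haarAddCircle] at h1
    simp only [ENNReal.ofReal_one, one_smul] at h1
    exact h1
  rw [ae_iff]
  convert this using 2
  ext X
  simp [χ]

/-- A periodized Bernoulli function can jump only at `0`. The hypothesis makes the set of `X` where
some argument `Y i - (A X) i` vanishes null, and dominated convergence applies. -/
lemma continuousAt_convBernoulli (A : Matrix d e ℤ) (k : e → ℕ) (l : d → ℕ) {Y : UnitAddTorus d}
    (hY : ∀ i, Y i = 0 → ∃ j, A i j ≠ 0) : ContinuousAt (convBernoulli A k l) Y := by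
  obtain ⟨C, hC⟩ := exists_abs_convBernoulli_integrand_le A k l
  refine continuousAt_of_dominated (bound := fun _ => C) (.of_forall fun Z => ?_)
    (.of_forall fun Z => .of_forall fun X => hC Z X) (integrable_const C) ?_
  · exact ((measurable_convBernoulli_integrand A k l).comp
      measurable_prodMk_left).aestronglyMeasurable
  · have : ∀ᵐ X : UnitAddTorus e, ∀ i, torusMap A X i ≠ Y i := by
      rw [ae_all_iff]
      intro i
      by_cases h : ∃ j, A i j ≠ 0
      · exact ae_torusMap_ne A h.choose_spec _
      · refine .of_forall fun X hX => h (hY i ?_)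
        rw [← hX, torusMap_apply]
        push Not at h
        simp [h]
    filter_upwards [this] with X hX
    refine continuousAt_const.mul (tendsto_finsetProd _ fun i _ => ?_)
    have h1 : ContinuousAt (fun Z : UnitAddTorus d => (Z - torusMap A X) i) Y :=
      ((continuous_apply i).sub continuous_const).continuousAt
    exact ContinuousAt.comp (g := periodizedBernoulli (l i))
      (f := fun Z : UnitAddTorus d => (Z - torusMap A X) i)
      (continuousAt_periodizedBernoulli (l i) (sub_ne_zero.2 (hX i).symm)) h1

/-- The projection of the real vector space to the torus. -/
def toTorus (y : d → ℝ) : UnitAddTorus d := fun i => (y i : UnitAddCircle)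

@[fun_prop]
lemma continuous_toTorus : Continuous (toTorus : (d → ℝ) → UnitAddTorus d) :=
  continuous_pi fun i => (AddCircle.continuous_mk' 1).comp (continuous_apply i)

lemma convBernoulli_toTorus (A : Matrix d e ℤ) (k : e → ℕ) (l : d → ℕ) (y : d → ℝ) :
    convBernoulli A k l (toTorus y) = ∫ x : e → ℝ in Set.Icc 0 1,
      (∏ j, bernoulliFun (k j) (x j)) *
        ∏ i, bernoulliFun (l i) (Int.fract (y i - ∑ j, x j * A i j)) := by
  have hset : {x : e → ℝ | ∀ i, x i ∈ Set.Ioc ((0 : e → ℝ) i) ((0 : e → ℝ) i + 1)} =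
      Set.pi Set.univ fun i => Set.Ioc ((0 : e → ℝ) i) ((1 : e → ℝ) i) := by
    ext x; simp
  have h1 : (Set.pi Set.univ fun i => Set.Ioo ((0 : e → ℝ) i) ((1 : e → ℝ) i)) =ᵐ[volume]
      Set.Icc (0 : e → ℝ) 1 := Measure.univ_pi_Ioo_ae_eq_Icc
  have h2 : (Set.pi Set.univ fun i => Set.Ioc ((0 : e → ℝ) i) ((1 : e → ℝ) i)) =ᵐ[volume]
      Set.Icc (0 : e → ℝ) 1 := Measure.univ_pi_Ioc_ae_eq_Icc
  -- Passing to the open cube avoids the faces `x_j = 1`, where `B_1(x_j)` differs from its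
  -- periodization.
  rw [convBernoulli, integral_preimage _ 0, hset, setIntegral_congr_set h1.symm,
    setIntegral_congr_set (h2.trans h1.symm)]
  refine setIntegral_congr_fun (MeasurableSet.univ_pi fun i => measurableSet_Ioo) fun x hx => ?_
  simp only [prodBernoulli]
  congr 1
  · refine Finset.prod_congr rfl fun j _ => ?_
    rw [periodizedBernoulli_coe, Int.fract_eq_self.2]
    have := hx j trivial
    exact ⟨this.1.le, this.2⟩
  · refine Finset.prod_congr rfl fun i _ => ?_
    rw [← periodizedBernoulli_coe]
    congr 1
    simp only [torusMap_apply, toTorus, Pi.sub_apply, AddCircle.coe_sub, sub_right_inj]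
    rw [← QuotientAddGroup.mk'_apply, map_sum]
    refine Finset.sum_congr rfl fun j _ => ?_
    rw [mul_comm, ← zsmul_eq_mul, map_zsmul]
    rfl

/-- A property that holds almost everywhere on the torus holds almost everywhere on the cube. -/
lemma ae_toTorus {p : UnitAddTorus d → Prop} (h : ∀ᵐ Y, p Y) :
    ∀ᵐ y : d → ℝ ∂volume.restrict (Set.pi Set.univ fun _ => Set.Ioo (0 : ℝ) 1),
      p (toTorus y) := by
  obtain ⟨t, hpt, ht, ht0⟩ := exists_measurable_superset_of_null (ae_iff.1 h)
  have h1 := lintegral_preimage (t.indicator 1) (0 : d → ℝ)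
  change _ = ∫⁻ x in _, ((t.indicator 1) ∘ toTorus) x at h1
  rw [lintegral_indicator_one ht, ht0, eq_comm, lintegral_eq_zero_iff (f := (t.indicator 1) ∘ toTorus)
    (((measurable_const.indicator ht : Measurable (t.indicator 1))).comp
      continuous_toTorus.measurable)] at h1
  have h2 := ae_restrict_of_ae_restrict_of_subset
    (s := Set.pi Set.univ fun _ => Set.Ioo (0 : ℝ) 1) (fun y hy i => by
      have := hy i trivial
      exact ⟨this.1, by simpa using this.2.le⟩) h1
  filter_upwards [h2] with y hy
  by_contra hn
  have : toTorus y ∈ t := hpt hn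
  have h3 : t.indicator (1 : UnitAddTorus d → ENNReal) (toTorus y) = 0 := hy
  rw [Set.indicator_of_mem this] at h3
  exact one_ne_zero h3

end Convolution

/-! ### Reducing products of Bernoulli coefficients to products along bases. -/

section Reduction

open Finset

variable {d J : Type*} [Fintype d] [DecidableEq J]

/-- The product of Bernoulli Fourier coefficients along a family of integer vectors. -/
def coef (v : J → d → ℤ) (k : J → ℕ) (I : Finset J) (m : d → ℤ) : ℂ :=
  ∏ j ∈ I, bernoulliFourierCoeff (k j) (v j ⬝ᵥ m)

/-- No nonzero integer vector is orthogonal to all `v j`, `j ∈ I`. -/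
def NonDeg (v : J → d → ℤ) (I : Finset J) : Prop :=
  ∀ m : d → ℤ, (∀ j ∈ I, v j ⬝ᵥ m = 0) → m = 0

/-- The rational span of the products of Bernoulli Fourier coefficients along bases. -/
def basisSpan (v : J → d → ℤ) : Submodule ℚ ((d → ℤ) → ℂ) :=
  Submodule.span ℚ {f | ∃ (k : J → ℕ) (B : Finset J), LinearIndepOn ℤ v (B : Set J) ∧
    NonDeg v B ∧ f = coef v k B}

variable {v : J → d → ℤ}

lemma mul_bernoulliFourierCoeff_zero (n : ℤ) :
    2 * Real.pi * Complex.I * n * bernoulliFourierCoeff 0 n = 0 := by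
  rcases eq_or_ne n 0 with rfl | hn
  · simp
  · simp [bernoulli_zero_fourier_coeff hn]

lemma mul_coef_zero {k : J → ℕ} {I : Finset J} {j : J} (hj : j ∈ I) (hk : k j = 0) (m : d → ℤ) :
    2 * Real.pi * Complex.I * (v j ⬝ᵥ m : ℤ) * coef v k I m = 0 := by
  rw [coef, ← mul_prod_erase _ _ hj, hk, ← mul_assoc, mul_bernoulliFourierCoeff_zero, zero_mul]

lemma mul_coef_succ {k : J → ℕ} {I : Finset J} {j : J} {l : ℕ} (hj : j ∈ I) (hk : k j = l + 1)
    (m : d → ℤ) :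
    2 * Real.pi * Complex.I * (v j ⬝ᵥ m : ℤ) * coef v k I m =
      (l + 1) * coef v (Function.update k j l) I m -
        if l = 0 then coef v k (I.erase j) m else 0 := by
  have h : ∏ i ∈ I.erase j, bernoulliFourierCoeff (Function.update k j l i) (v i ⬝ᵥ m) =
      ∏ i ∈ I.erase j, bernoulliFourierCoeff (k i) (v i ⬝ᵥ m) :=
    prod_congr rfl fun i hi => by rw [Function.update_of_ne (ne_of_mem_erase hi)]
  rw [coef, coef, ← mul_prod_erase _ _ hj, ← mul_prod_erase _ _ hj, hk, ← mul_assoc,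
    mul_bernoulliFourierCoeff_succ, h, Function.update_self, coef]
  split_ifs <;> ring

/-- A vector that occurs in a linear relation is a rational combination of the others, so
orthogonality to the others suffices. -/
lemma NonDeg.erase {I : Finset J} (hI : NonDeg v I) {a : J → ℤ}
    (ha : ∑ j ∈ I, a j • v j = 0) {j : J} (hj : j ∈ I) (haj : a j ≠ 0) : NonDeg v (I.erase j) := by
  intro m hm
  refine hI m fun i hi => ?_
  rcases eq_or_ne i j with rfl | hij
  · have h := congrArg (· ⬝ᵥ m) ha
    simp only [sum_dotProduct, smul_dotProduct, zero_dotProduct] at h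
    rw [← add_sum_erase _ _ hi, sum_eq_zero fun l hl => by rw [hm l hl, smul_zero]] at h
    simpa [haj] using h
  · exact hm i (mem_erase.2 ⟨hij, hi⟩)

/-- A relation `∑ a_j v_j = 0` gives `∑ a_j (v_j · m) = 0`. Multiplying a product by this and
lowering one index in each term is a partial fraction identity that trades exponents until a vector
can be dropped. -/
lemma coef_mem_basisSpan {I : Finset J} (hI : NonDeg v I) (k : J → ℕ) :
    coef v k I ∈ basisSpan v := by
  -- The outer induction counts vectors plus nonzero exponents; the inner one, for a fixed relation
  -- and pivot `j₀`, is on the total exponent of the other vectors in the relation.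
  generalize hN : #I + #(I.filter (k · ≠ 0)) = N
  induction N using Nat.strong_induction_on generalizing I k with
  | _ N ih =>
    by_cases hli : LinearIndepOn ℤ v (I : Set J)
    · exact Submodule.subset_span ⟨k, I, hli, hI, rfl⟩
    rw [linearIndepOn_finset_iff] at hli
    push Not at hli
    obtain ⟨a, ha, j₁, hj₁, haj₁⟩ := hli
    have hrel : ∀ m, ∑ j ∈ I, a j * (v j ⬝ᵥ m) = 0 := fun m => by
      have h := congrArg (· ⬝ᵥ m) ha
      simpa only [sum_dotProduct, smul_dotProduct, zero_dotProduct, smul_eq_mul] using h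
    -- If all exponents along the relation vanish, the factors are indicators of `v_j · m = 0`, and
    -- the relation makes one of them redundant.
    by_cases hk : ∀ j ∈ I, a j ≠ 0 → k j = 0
    · have h : coef v k I = coef v k (I.erase j₁) := by
        ext m
        rw [coef, ← mul_prod_erase _ _ hj₁, hk j₁ hj₁ haj₁]
        by_cases h0 : coef v k (I.erase j₁) m = 0
        · rw [← coef, h0, mul_zero]
        have h1 : ∀ i ∈ I.erase j₁, a i * (v i ⬝ᵥ m) = 0 := by
          intro i hi
          by_contra hne
          rw [mul_eq_zero, not_or] at hne
          refine h0 (prod_eq_zero hi ?_)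
          rw [hk i (mem_of_mem_erase hi) hne.1, bernoulli_zero_fourier_coeff hne.2]
        have h2 := hrel m
        rw [← add_sum_erase _ _ hj₁, sum_eq_zero h1, add_zero, mul_eq_zero] at h2
        rw [h2.resolve_left haj₁, bernoulliFourierCoeff_zero_zero, one_mul, coef]
      rw [h]
      refine ih _ ?_ (hI.erase ha hj₁ haj₁) k rfl
      rw [← hN]
      exact add_lt_add_of_lt_of_le (card_erase_lt_of_mem hj₁)
        (card_le_card (filter_subset_filter _ (erase_subset _ _)))
    push Not at hk
    obtain ⟨j₀, hj₀, haj₀, hkj₀⟩ := hk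
    have hle : #I + #(I.filter (k · ≠ 0)) ≤ N := hN.le
    clear hN haj₁ hj₁
    generalize hn : ∑ j ∈ I with j ≠ j₀ ∧ a j ≠ 0, k j = n
    induction n using Nat.strong_induction_on generalizing k with
    | _ n ihn =>
      -- The exponent at the pivot is raised so that lowering it again returns `k`. Since `k j₀ ≠
      -- 0`, this term has no Dirac contribution.
      set k' := Function.update k j₀ (k j₀ + 1) with hk'
      have hpos : ∀ j, k' j = 0 ↔ k j = 0 := by
        intro j
        rcases eq_or_ne j j₀ with rfl | hne
        · simp [hk', hkj₀]
        · simp [hk', hne]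
      have hfilter : I.filter (k' · ≠ 0) = I.filter (k · ≠ 0) :=
        filter_congr fun j _ => not_congr (hpos j)
      have hterm : ∀ j ∈ I, j ≠ j₀ → (fun m => (a j : ℂ) *
          (2 * Real.pi * Complex.I * (v j ⬝ᵥ m : ℤ) * coef v k' I m)) ∈ basisSpan v := by
        intro j hj hne
        by_cases haj : a j = 0
        · simp only [haj, Int.cast_zero, zero_mul]
          exact Submodule.zero_mem _
        have hkk : k' j = k j := Function.update_of_ne hne _ _
        obtain h0 | ⟨l, hl⟩ : k' j = 0 ∨ ∃ l, k' j = l + 1 := by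
          rcases h : k' j with _ | l
          · exact .inl rfl
          · exact .inr ⟨l, rfl⟩
        · simp only [mul_coef_zero hj h0, mul_zero]
          exact Submodule.zero_mem _
        have hmem : j ∈ I.filter (k' · ≠ 0) := mem_filter.2 ⟨hj, by omega⟩
        have hfun : (fun m => (a j : ℂ) *
            (2 * Real.pi * Complex.I * (v j ⬝ᵥ m : ℤ) * coef v k' I m)) =
            ((a j * (l + 1) : ℤ) : ℚ) • coef v (Function.update k' j l) I -
              (if l = 0 then (a j : ℚ) else 0) • coef v k' (I.erase j) := by
          ext m
          rw [mul_coef_succ hj hl]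
          simp only [Pi.sub_apply, Pi.smul_apply, Rat.smul_def]
          split_ifs <;> push_cast <;> ring
        rw [hfun]
        refine Submodule.sub_mem _ (Submodule.smul_mem _ _ ?_) ?_
        -- If the lowered exponent is `0`, there are fewer nonzero exponents and the outer induction
        -- applies; otherwise the inner sum drops. The Dirac term, which erases `j`, is handled
        -- separately by the outer induction.
        · rcases eq_or_ne l 0 with rfl | hl0
          · refine ih _ ?_ hI _ rfl
            refine lt_of_lt_of_le (Nat.add_lt_add_left (card_lt_card (ssubset_iff_of_subset
              (fun i hi => ?_) |>.2 ⟨j, hfilter ▸ hmem, by simp⟩)) _) hle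
            rw [← hfilter, mem_filter]
            rw [mem_filter] at hi
            refine ⟨hi.1, fun h => hi.2 ?_⟩
            rcases eq_or_ne i j with rfl | hij
            · simp
            · rwa [Function.update_of_ne hij]
          · refine ihn _ ?_ (Function.update k' j l) ?_ ?_ rfl
            · rw [← hn]
              refine sum_lt_sum (fun i hi => ?_) ⟨j, by simp [hj, hne, haj], ?_⟩
              · rw [mem_filter] at hi
                rcases eq_or_ne i j with rfl | hij
                · rw [Function.update_self]; omega
                · rw [Function.update_of_ne hij, hk', Function.update_of_ne hi.2.1]
              · rw [Function.update_self]; omega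
            · rw [Function.update_of_ne hne.symm]
              simp [hk']
            · refine le_trans (Nat.add_le_add_left (card_le_card fun i hi => ?_) _) hle
              rw [← hfilter, mem_filter]
              rw [mem_filter] at hi
              refine ⟨hi.1, fun h => hi.2 ?_⟩
              rcases eq_or_ne i j with rfl | hij
              · omega
              · rwa [Function.update_of_ne hij]
        · refine Submodule.smul_mem _ _ (ih _ ?_ (hI.erase ha hj haj) _ rfl)
          refine lt_of_lt_of_le (add_lt_add_of_lt_of_le (card_erase_lt_of_mem hj)
            (card_le_card ?_)) hle
          rw [← hfilter]
          exact filter_subset_filter _ (erase_subset _ _)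
      have hsum := Submodule.sum_mem (basisSpan v) (t := I.erase j₀) fun j hj =>
        hterm j (mem_of_mem_erase hj) (ne_of_mem_erase hj)
      have hc : (a j₀ * (k j₀ + 1) : ℚ) ≠ 0 := by
        have : (a j₀ : ℚ) ≠ 0 := by exact_mod_cast haj₀
        positivity
      have hmain : (a j₀ * (k j₀ + 1) : ℚ) • coef v k I = -∑ j ∈ I.erase j₀, fun m => (a j : ℂ) *
          (2 * Real.pi * Complex.I * (v j ⬝ᵥ m : ℤ) * coef v k' I m) := by
        ext m
        have h1 := mul_coef_succ (v := v) hj₀ (k := k') (l := k j₀) (by simp [hk']) m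
        rw [if_neg hkj₀, sub_zero] at h1
        have h2 : Function.update k' j₀ (k j₀) = k := by simp [hk']
        rw [h2] at h1
        have h3 : ∑ j ∈ I, (a j : ℂ) *
            (2 * Real.pi * Complex.I * (v j ⬝ᵥ m : ℤ) * coef v k' I m) = 0 := by
          have := congrArg (Int.cast : ℤ → ℂ) (hrel m)
          push_cast at this
          rw [← mul_zero (2 * Real.pi * Complex.I * coef v k' I m), ← this, mul_sum]
          exact sum_congr rfl fun j _ => by ring
        rw [← add_sum_erase _ _ hj₀, h1] at h3
        simp only [Pi.smul_apply, Pi.neg_apply, Finset.sum_apply, Rat.smul_def]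
        push_cast
        linear_combination h3
      rw [← inv_smul_smul₀ hc (coef v k I), hmain]
      exact Submodule.smul_mem _ _ (Submodule.neg_mem _ hsum)

end Reduction

/-! ### Integer bases, generic points and integrality of coordinates. -/

section Basis

variable {d J : Type*} [Fintype d] [DecidableEq d] [DecidableEq J]

/-- The matrix whose columns are the vectors of a finite family. -/
def colMatrix (v : J → d → ℤ) (B : Finset J) : Matrix d B ℤ := Matrix.of fun i j => v j i

/-- A nondegenerate linearly independent family has an inverse matrix up to a natural number. -/
lemma exists_colMatrix_inverse {v : J → d → ℤ} {B : Finset J}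
    (hB : LinearIndepOn ℤ v (B : Set J)) (hnd : NonDeg v B) :
    B.card = Fintype.card d ∧ ∃ (D : ℕ) (A' : Matrix B d ℤ), D ≠ 0 ∧
      colMatrix v B * A' = (D : ℤ) • (1 : Matrix d d ℤ) ∧
      A' * colMatrix v B = (D : ℤ) • (1 : Matrix B B ℤ) := by
  have hinj : Function.Injective (colMatrix v B).mulVecLin := by
    rw [← LinearMap.ker_eq_bot, LinearMap.ker_eq_bot']
    intro a ha
    have h := Fintype.linearIndependent_iff.1 (linearIndependent_restrict_iff.2 hB) a (by
      ext i
      have := congrFun ha i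
      simpa [Matrix.mulVec, dotProduct, colMatrix, mul_comm] using this)
    exact funext h
  have hinj' : Function.Injective (colMatrix v B).transpose.mulVecLin := by
    rw [← LinearMap.ker_eq_bot, LinearMap.ker_eq_bot']
    intro m hm
    refine hnd m fun j hj => ?_
    exact congrFun hm ⟨j, hj⟩
  have hcard : Fintype.card B = Fintype.card d :=
    le_antisymm (card_le_of_injective ℤ _ hinj) (card_le_of_injective ℤ _ hinj')
  refine ⟨by simpa using hcard, ?_⟩
  let σ : B ≃ d := Fintype.equivOfCardEq hcard
  let M : Matrix d d ℤ := (colMatrix v B).submatrix id σ.symm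
  have hdet : M.det ≠ 0 := by
    intro h
    obtain ⟨w, hw, hMw⟩ := Matrix.exists_mulVec_eq_zero_iff.2 h
    refine hw ?_
    have h1 : (colMatrix v B).mulVecLin (w ∘ σ) = 0 := by
      rw [← hMw, Matrix.mulVecLin_apply]
      ext i
      simp only [Matrix.mulVec, dotProduct, M, Matrix.submatrix_apply, id, Function.comp_apply]
      exact Fintype.sum_equiv σ _ _ fun j => by simp
    have h2 := hinj (h1.trans (map_zero _).symm)
    ext i
    simpa using congrFun h2 (σ.symm i)
  -- The adjugate is multiplied once more by the determinant so that `D` is a positive natural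
  -- number whatever the sign of the determinant.
  refine ⟨M.det.natAbs ^ 2, (M.det • M.adjugate).submatrix σ id, by positivity, ?_, ?_⟩
  · have : colMatrix v B = M.submatrix id σ := by ext; simp [M]
    rw [this, Matrix.submatrix_mul_equiv, Matrix.mul_smul, Matrix.mul_adjugate, smul_smul]
    simp [sq]
  · have : colMatrix v B = M.submatrix id σ := by ext; simp [M]
    rw [this, ← Matrix.submatrix_mul _ _ _ id _ Function.bijective_id, Matrix.smul_mul,
      Matrix.adjugate_mul, smul_smul]
    ext i j
    simp only [Matrix.submatrix_apply, Matrix.smul_apply, Matrix.one_apply,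
      EmbeddingLike.apply_eq_iff_eq, sq, Int.natCast_mul]
    simp [← sq]

/-- A point of `ℝ^d` avoiding all integer translates of the hyperplanes spanned by the `v j`. -/
def Generic (v : J → d → ℤ) (y : d → ℝ) : Prop :=
  ∀ R : Finset J, LinearIndepOn ℝ (fun j i => (v j i : ℝ)) (R : Set J) →
    R.card + 1 = Fintype.card d → ∀ c : d → ℤ,
      (fun i => y i - c i) ∉ Submodule.span ℝ ((fun j i => (v j i : ℝ)) '' (R : Set J))

/-- A function on the torus that is a rational polynomial on each preconnected generic set. -/
def PiecewisePoly (v : J → d → ℤ) (f : UnitAddTorus d → ℝ) : Prop :=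
  ∀ U : Set (d → ℝ), IsPreconnected U → (∀ y ∈ U, Generic v y) →
    ∃ p : MvPolynomial d ℚ, ∀ y ∈ U, f (toTorus y) = MvPolynomial.aeval y p

lemma linearIndepOn_real_of_inverse {v : J → d → ℤ} {B : Finset J} {D : ℕ} {A' : Matrix B d ℤ}
    (hD : D ≠ 0) (h : A' * colMatrix v B = (D : ℤ) • (1 : Matrix B B ℤ)) :
    LinearIndepOn ℝ (fun j i => (v j i : ℝ)) (B : Set J) := by
  rw [← linearIndependent_restrict_iff]
  refine Fintype.linearIndependent_iff.2 fun a ha j => ?_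
  have h1 : ∑ i, (A' j i : ℝ) * ∑ l : B, a l * v l i = 0 := by
    refine Finset.sum_eq_zero fun i _ => ?_
    have := congrFun ha i
    simp only [Finset.sum_apply, Pi.smul_apply, smul_eq_mul, Pi.zero_apply] at this
    exact mul_eq_zero_of_right _ this
  have h2 : ∀ l : B, ∑ i, (A' j i : ℝ) * v l i = if j = l then (D : ℝ) else 0 := by
    intro l
    have := congrFun (congrFun h j) l
    simp only [Matrix.mul_apply, colMatrix, Matrix.of_apply, Matrix.smul_apply, Matrix.one_apply,
      smul_eq_mul, mul_ite, mul_one, mul_zero] at this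
    have := congrArg (Int.cast : ℤ → ℝ) this
    push_cast at this
    exact this
  have h3 : ∑ i, (A' j i : ℝ) * ∑ l : B, a l * v l i = a j * D := by
    simp_rw [Finset.mul_sum]
    rw [Finset.sum_comm]
    calc ∑ l : B, ∑ i, (A' j i : ℝ) * (a l * v l i)
        = ∑ l : B, a l * ∑ i, (A' j i : ℝ) * v l i := by
          refine Finset.sum_congr rfl fun l _ => ?_
          rw [Finset.mul_sum]
          exact Finset.sum_congr rfl fun i _ => by ring
      _ = a j * D := by simp [h2]
  rw [h3] at h1
  simpa [hD] using h1

/-- The coordinates of a generic point with respect to a basis of vectors `v j` are not integral. -/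
lemma Generic.coordinate_ne {v : J → d → ℤ} {y : d → ℝ} (hy : Generic v y) {B : Finset J} {D : ℕ}
    {A' : Matrix B d ℤ} (hcard : B.card = Fintype.card d) (hD : D ≠ 0)
    (h : colMatrix v B * A' = (D : ℤ) • (1 : Matrix d d ℤ))
    (h' : A' * colMatrix v B = (D : ℤ) • (1 : Matrix B B ℤ)) (j : B) (c : d → ℤ) (n : ℤ) :
    (∑ i, (A' j i : ℝ) * (y i + c i)) / D ≠ n := by
  intro hn
  have hD' : (D : ℝ) ≠ 0 := by exact_mod_cast hD
  refine hy (B.erase j) ((linearIndepOn_real_of_inverse hD h').mono (by simp)) ?_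
    -- If the `j`-th coordinate of `y + c` is `n`, then `y - (n v_j - c)` lies in the span of the
    -- other basis vectors, against genericity.
    (fun i => n * v j i - c i) ?_
  · rw [Finset.card_erase_of_mem j.2, ← hcard]
    have := Finset.card_pos.2 ⟨_, j.2⟩
    omega
  have key : (fun i => y i - ((n * v j i - c i : ℤ) : ℝ)) =
      ∑ l ∈ Finset.univ.erase j, ((∑ i, (A' l i : ℝ) * (y i + c i)) / D) •
        (fun i => (v l i : ℝ)) := by
    ext i
    have h1 : ∑ l : B, (v l i : ℝ) * ∑ i', (A' l i' : ℝ) * (y i' + c i') = D * (y i + c i) := by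
      simp_rw [Finset.mul_sum]
      rw [Finset.sum_comm]
      have h2 : ∀ i', ∑ l : B, (v l i : ℝ) * (A' l i') = if i = i' then (D : ℝ) else 0 := by
        intro i'
        have := congrFun (congrFun h i) i'
        simp only [Matrix.mul_apply, colMatrix, Matrix.of_apply, Matrix.smul_apply,
          Matrix.one_apply, smul_eq_mul, mul_ite, mul_one, mul_zero] at this
        have := congrArg (Int.cast : ℤ → ℝ) this
        push_cast at this
        exact this
      simp_rw [← mul_assoc, ← Finset.sum_mul, h2]
      simp
    rw [← Finset.add_sum_erase _ _ (Finset.mem_univ j), (div_eq_iff hD').1 hn] at h1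
    simp only [Finset.sum_apply, Pi.smul_apply, smul_eq_mul]
    have h3 : ∑ l ∈ Finset.univ.erase j, (∑ i, (A' l i : ℝ) * (y i + c i)) / D * (v l i : ℝ) =
        (∑ l ∈ Finset.univ.erase j, (v l i : ℝ) * ∑ i', (A' l i' : ℝ) * (y i' + c i')) / D := by
      rw [Finset.sum_div]
      exact Finset.sum_congr rfl fun l _ => by ring
    rw [h3, eq_div_iff hD', eq_sub_of_add_eq' h1]
    push_cast
    ring
  rw [key]
  refine Submodule.sum_mem _ fun l hl => Submodule.smul_mem _ _ (Submodule.subset_span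
    ⟨l, ?_, rfl⟩)
  simp only [Finset.coe_erase, Set.mem_sdiff, Finset.mem_coe, Set.mem_singleton_iff]
  exact ⟨l.2, fun h => Finset.ne_of_mem_erase hl (Subtype.ext h)⟩

lemma floor_eq_of_isPreconnected {X : Type*} [TopologicalSpace X] {U : Set X}
    (hU : IsPreconnected U) {t : X → ℝ} (ht : ContinuousOn t U) (hn : ∀ y ∈ U, ∀ n : ℤ, t y ≠ n)
    {y z : X} (hy : y ∈ U) (hz : z ∈ U) : ⌊t y⌋ = ⌊t z⌋ := by
  wlog h : ⌊t y⌋ < ⌊t z⌋ generalizing y z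
  · rcases lt_trichotomy ⌊t y⌋ ⌊t z⌋ with h' | h' | h'
    · exact (h h').elim
    · exact h'
    · exact (this hz hy h').symm
  obtain ⟨x, hx, hxt⟩ := hU.intermediate_value hy hz ht
    (show (⌊t z⌋ : ℝ) ∈ Set.Icc (t y) (t z) from ⟨(Int.floor_lt.1 h).le, Int.floor_le _⟩)
  exact (hn x hx _ hxt).elim

end Basis

/-! ### Averages over torsion points realize the coefficients along a basis. -/

section Average

variable {d e : Type*} [Fintype d] [Fintype e] [DecidableEq d] {D : ℕ} [NeZero D]

/-- The average of a product of Bernoulli functions, pulled back along an integer matrix, over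
the translates by the points of order dividing `D`. -/
def avgBernoulli (A' : Matrix e d ℤ) (k : e → ℕ) (D : ℕ) [NeZero D] (Z : UnitAddTorus d) : ℝ :=
  ((D : ℝ) ^ Fintype.card d)⁻¹ *
    ∑ q : d → ZMod D, prodBernoulli k (torusMap A' (Z + fun i => ZMod.toAddCircle (q i)))

lemma avgBernoulli_add (A' : Matrix e d ℤ) (k : e → ℕ) (Z : UnitAddTorus d) (q : d → ZMod D) :
    avgBernoulli A' k D (Z + fun i => ZMod.toAddCircle (q i)) = avgBernoulli A' k D Z := by
  simp only [avgBernoulli]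
  congr 1
  refine Fintype.sum_equiv (Equiv.addLeft q) _ _ fun q' => ?_
  congr 2
  ext i
  simp [add_assoc]

/-- A set-theoretic division by `D` on the torus. -/
def torusDiv (D : ℕ) (Y : UnitAddTorus d) : UnitAddTorus d :=
  fun i => (((AddCircle.equivIco (1 : ℝ) 0 (Y i) : ℝ) / D : ℝ) : UnitAddCircle)

lemma measurable_torusDiv (D : ℕ) : Measurable (torusDiv D : UnitAddTorus d → UnitAddTorus d) :=
  measurable_pi_lambda _ fun i => (AddCircle.continuous_mk' 1).measurable.comp
    ((measurable_subtype_coe.comp ((AddCircle.measurableEquivIco (1 : ℝ) 0).measurable.comp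
      (measurable_pi_apply i))).div_const _)

/-- The two divisions by `D` of the point of `y` differ by the torsion point `⌊y_i⌋ / D`, which the
average does not see. So the choice made in `torusDiv` is harmless, and the value is given by linear
forms in `y`. -/
lemma avgBernoulli_torusDiv (A' : Matrix e d ℤ) (k : e → ℕ) (y : d → ℝ) :
    avgBernoulli A' k D (torusDiv D (toTorus y)) =
      avgBernoulli A' k D (toTorus fun i => y i / D) := by
  rw [← avgBernoulli_add A' k (torusDiv D (toTorus y)) (fun i => ((⌊y i⌋ : ℤ) : ZMod D))]
  congr 1
  ext i
  simp only [Pi.add_apply, torusDiv, toTorus, ZMod.toAddCircle_intCast]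
  rw [← AddCircle.coe_add, AddCircle.coe_equivIco_mk_apply, div_one, mul_one, ← add_div,
    Int.fract_add_floor]

lemma toTorus_surjective : Function.Surjective (toTorus : (d → ℝ) → UnitAddTorus d) := fun Y =>
  ⟨fun i => AddCircle.equivIco (1 : ℝ) 0 (Y i), funext fun _ => AddCircle.coe_equivIco⟩

lemma avgBernoulli_torusDiv_smul (A' : Matrix e d ℤ) (k : e → ℕ) (Z : UnitAddTorus d) :
    avgBernoulli A' k D (torusDiv D ((D : ℤ) • Z)) = avgBernoulli A' k D Z := by
  obtain ⟨z, rfl⟩ := toTorus_surjective Z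
  have h : (D : ℤ) • toTorus z = toTorus fun i => (D : ℝ) * z i := by
    ext i
    change (D : ℤ) • (z i : UnitAddCircle) = _
    rw [← AddCircle.coe_zsmul]
    simp [toTorus]
  rw [h, avgBernoulli_torusDiv]
  congr 2
  ext i
  rw [mul_div_cancel_left₀]
  exact_mod_cast NeZero.ne D

lemma bddMeas_avgBernoulli (A' : Matrix e d ℤ) (k : e → ℕ) :
    BddMeas (avgBernoulli A' k D) :=
  (BddMeas.sum _ fun _ _ => (bddMeas_prodBernoulli k).comp
    ((continuous_torusMap A').comp (continuous_add_const _)).measurable).const_mul _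

/-- After the substitution `Y = D Z`, the character becomes `(m A)` evaluated at `A' Z` because `A
A' = D`. Each translate then contributes the coefficient at `m A` of a product of Bernoulli
functions, pulled back along the surjection `A'`. -/
lemma mFourierCoeff_avgBernoulli_torusDiv [DecidableEq e] {A : Matrix d e ℤ} {A' : Matrix e d ℤ}
    (h : A * A' = (D : ℤ) • (1 : Matrix d d ℤ)) (h' : A' * A = (D : ℤ) • (1 : Matrix e e ℤ))
    (k : e → ℕ) (m : d → ℤ) :
    mFourierCoeff (fun Y => (avgBernoulli A' k D (torusDiv D Y) : ℂ)) m =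
      ∏ j, bernoulliFourierCoeff (k j) (Matrix.vecMul m A j) := by
  have hD : (D : ℤ) ≠ 0 := by exact_mod_cast NeZero.ne D
  have hms : ∀ {u : UnitAddTorus d → ℝ}, BddMeas u → ∀ n,
      Integrable (fun x => mFourier n x * (u x : ℂ)) := by
    rintro u ⟨hm, C, hC⟩ n
    refine Integrable.of_bound ((mFourier n).continuous.measurable.mul
      (Complex.measurable_ofReal.comp hm)).aestronglyMeasurable C (.of_forall fun x => ?_)
    rw [norm_mul, norm_mFourier_apply, one_mul]
    simpa using hC x
  have hsmul : ∀ Z : UnitAddTorus d, mFourier (-m) ((D : ℤ) • Z) =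
      mFourier (-Matrix.vecMul m A) (torusMap A' Z) := fun Z => by
    rw [← Matrix.neg_vecMul, ← mFourier_torusMap, torusMap_torusMap, h, torusMap_smul_one]
  have hsurj : Function.Surjective (torusMap ((D : ℤ) • (1 : Matrix d d ℤ))) := fun Y => by
    obtain ⟨Z, hZ⟩ := zsmul_torus_surjective hD Y
    exact ⟨Z, (torusMap_smul_one _ _).trans hZ⟩
  have hg := (bddMeas_avgBernoulli (D := D) A' k).comp (measurable_torusDiv (d := d) D)
  have hF : Measurable fun Y => mFourier (-m) Y • (avgBernoulli A' k D (torusDiv D Y) : ℂ) :=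
    (mFourier (-m)).continuous.measurable.smul (Complex.measurable_ofReal.comp hg.1)
  rw [mFourierCoeff, ← integral_comp_torus (continuous_torusMap _) hsurj hF]
  simp only [torusMap_smul_one, avgBernoulli_torusDiv_smul, smul_eq_mul]
  have hq : ∀ q : d → ZMod D, ∫ Z, mFourier (-m) ((D : ℤ) • Z) *
      (prodBernoulli k (torusMap A' (Z + fun i => ZMod.toAddCircle (q i))) : ℂ) =
      ∏ j, bernoulliFourierCoeff (k j) (Matrix.vecMul m A j) := by
    intro q
    have hDq : (D : ℤ) • (fun i => ZMod.toAddCircle (q i) : UnitAddTorus d) = 0 := by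
      ext i
      change (D : ℤ) • ZMod.toAddCircle (q i) = 0
      rw [← map_zsmul, natCast_zsmul, nsmul_eq_mul, CharP.cast_eq_zero, zero_mul, map_zero]
    let G : UnitAddTorus d → ℂ := fun Z => mFourier (-Matrix.vecMul m A) (torusMap A' Z) *
      (prodBernoulli k (torusMap A' Z) : ℂ)
    have h1 : ∀ Z : UnitAddTorus d, mFourier (-m) ((D : ℤ) • Z) *
        (prodBernoulli k (torusMap A' (Z + fun i => ZMod.toAddCircle (q i))) : ℂ) =
        G (Z + fun i => ZMod.toAddCircle (q i)) := by
      intro Z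
      simp only [G]
      rw [← hsmul, smul_add, hDq, add_zero]
    rw [integral_congr_ae (.of_forall h1), integral_add_right_eq_self, ← mFourierCoeff_prodBernoulli,
      mFourierCoeff, ← integral_comp_torus (continuous_torusMap A') (torusMap_surjective hD h')]
    · rfl
    · exact (mFourier _).continuous.measurable.smul
        (Complex.measurable_ofReal.comp (bddMeas_prodBernoulli k).1)
  have hsplit : ∀ Z : UnitAddTorus d, mFourier (-m) ((D : ℤ) • Z) * (avgBernoulli A' k D Z : ℂ) =
      ((D : ℂ) ^ Fintype.card d)⁻¹ * ∑ q : d → ZMod D, mFourier (-m) ((D : ℤ) • Z) *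
        (prodBernoulli k (torusMap A' (Z + fun i => ZMod.toAddCircle (q i))) : ℂ) := by
    intro Z
    rw [← Finset.mul_sum, avgBernoulli]
    push_cast
    ring
  rw [integral_congr_ae (.of_forall hsplit), integral_const_mul, integral_finsetSum]
  · have hD' : (D : ℂ) ≠ 0 := by exact_mod_cast NeZero.ne D
    simp_rw [hq]
    -- All `D ^ card d` translates contribute equally, which cancels the normalization.
    rw [Finset.sum_const, Finset.card_univ, Fintype.card_pi]
    simp [ZMod.card, hD']
  · intro q _
    simp_rw [hsmul, mFourier_torusMap]
    exact hms ((bddMeas_prodBernoulli k).comp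
      ((continuous_torusMap A').comp (continuous_add_const _)).measurable) _

lemma aeval_bernoulli (k : ℕ) (y : d → ℝ) (p : MvPolynomial d ℚ) :
    MvPolynomial.aeval y (Polynomial.aeval p (Polynomial.bernoulli k)) =
      bernoulliFun k (MvPolynomial.aeval y p) := by
  rw [bernoulliFun, Polynomial.eval_map_algebraMap, Polynomial.aeval_algHom_apply]

lemma avgBernoulli_toTorus_div (A' : Matrix e d ℤ) (k : e → ℕ) (y : d → ℝ) :
    avgBernoulli A' k D (toTorus fun i => y i / D) = ((D : ℝ) ^ Fintype.card d)⁻¹ *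
      ∑ q : d → ZMod D, ∏ j, bernoulliFun (k j)
        (Int.fract ((∑ i, (A' j i : ℝ) * (y i + ((q i).val : ℤ))) / D)) := by
  rw [avgBernoulli]
  congr 1
  refine Finset.sum_congr rfl fun q _ => Finset.prod_congr rfl fun j _ => ?_
  rw [← periodizedBernoulli_coe]
  congr 1
  rw [torusMap_apply, Finset.sum_div, ← QuotientAddGroup.mk'_apply, map_sum]
  refine Finset.sum_congr rfl fun i _ => ?_
  have : ZMod.toAddCircle (q i) = ((((q i).val : ℤ) : ℝ) / D : ℝ) := by
    conv_lhs => rw [← ZMod.natCast_zmod_val (q i)]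
    exact_mod_cast ZMod.toAddCircle_intCast (N := D) ((q i).val : ℤ)
  rw [Pi.add_apply, toTorus, this, ← AddCircle.coe_add, ← AddCircle.coe_zsmul,
    QuotientAddGroup.mk'_apply]
  congr 1
  rw [zsmul_eq_mul]
  ring

end Average

/-! ### Piecewise polynomial functions with prescribed Fourier coefficients. -/

section Main

variable {d J : Type*} [Fintype d] [DecidableEq J] {v : J → d → ℤ}

open MvPolynomial in
-- On a preconnected generic set the linear forms inside the fractional parts never take integer
-- values. Their floors are constant there, so each fractional part is a rational affine form, with
-- the floor read off at a base point `y₀`.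
lemma exists_function_of_basis {B : Finset J} (hB : LinearIndepOn ℤ v (B : Set J))
    (hnd : NonDeg v B) (k : J → ℕ) :
    ∃ f : UnitAddTorus d → ℝ, BddMeas f ∧
      (∀ m, mFourierCoeff (fun Y => (f Y : ℂ)) m = coef v k B m) ∧ PiecewisePoly v f := by
  classical
  obtain ⟨hcard, D, A', hD, h, h'⟩ := exists_colMatrix_inverse hB hnd
  have : NeZero D := ⟨hD⟩
  refine ⟨fun Y => avgBernoulli A' (fun j => k j) D (torusDiv D Y),
    (bddMeas_avgBernoulli _ _).comp (measurable_torusDiv D), fun m => ?_, ?_⟩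
  · rw [mFourierCoeff_avgBernoulli_torusDiv h h', coef,
      ← Finset.prod_coe_sort B fun j => bernoulliFourierCoeff (k j) (v j ⬝ᵥ m)]
    refine Finset.prod_congr rfl fun j _ => ?_
    congr 1
    exact dotProduct_comm _ _
  · intro U hU hgen
    let t : (d → ZMod D) → B → (d → ℝ) → ℝ := fun q j y =>
      (∑ i, (A' j i : ℝ) * (y i + ((q i).val : ℤ))) / D
    rcases U.eq_empty_or_nonempty with rfl | ⟨y₀, hy₀⟩
    · exact ⟨0, by simp⟩
    let ℓ : (d → ZMod D) → B → MvPolynomial d ℚ := fun q j =>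
      C (1 / (D : ℚ)) * (∑ i, C (A' j i : ℚ) * (X i + C ((q i).val : ℚ))) - C (⌊t q j y₀⌋ : ℚ)
    refine ⟨C (((D : ℚ) ^ Fintype.card d)⁻¹) * ∑ q : d → ZMod D,
      ∏ j, Polynomial.aeval (ℓ q j) (Polynomial.bernoulli (k j)), fun y hy => ?_⟩
    simp only [map_mul, map_sum, map_prod, aeval_bernoulli]
    rw [avgBernoulli_torusDiv, avgBernoulli_toTorus_div]
    congr 1
    · simp
    refine Finset.sum_congr rfl fun q _ => Finset.prod_congr rfl fun j _ => ?_
    congr 1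
    have hfl : ⌊t q j y⌋ = ⌊t q j y₀⌋ := by
      refine floor_eq_of_isPreconnected hU (Continuous.continuousOn (by fun_prop)) ?_ hy hy₀
      intro z hz n
      exact (hgen z hz).coordinate_ne hcard hD h h' j (fun i => (q i).val) n
    change Int.fract (t q j y) = _
    rw [Int.fract, hfl]
    simp only [ℓ, t, map_sub, map_mul, map_sum, map_add, algHom_C, aeval_X]
    simp only [eq_ratCast]
    push_cast
    ring

/-- Every function on the lattice in the span of the products along bases is the family of Fourier
coefficients of a piecewise polynomial function. -/
lemma exists_function_of_mem_basisSpan {c : (d → ℤ) → ℂ} (hc : c ∈ basisSpan v) :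
    ∃ f : UnitAddTorus d → ℝ, BddMeas f ∧
      (∀ m, mFourierCoeff (fun Y => (f Y : ℂ)) m = c m) ∧ PiecewisePoly v f := by
  induction hc using Submodule.span_induction with
  | mem c hc =>
    obtain ⟨k, B, hB, hnd, rfl⟩ := hc
    exact exists_function_of_basis hB hnd k
  | zero =>
    refine ⟨fun _ => 0, ⟨measurable_const, 0, by simp⟩, by simp [mFourierCoeff], fun U _ _ =>
      ⟨0, by simp⟩⟩
  | add c c' _ _ ih ih' =>
    obtain ⟨f, hf, hfc, hfp⟩ := ih
    obtain ⟨f', hf', hfc', hfp'⟩ := ih'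
    refine ⟨fun x => f x + f' x, hf.add hf', fun m => ?_, fun U hU hg => ?_⟩
    · rw [mFourierCoeff_add hf hf', hfc, hfc', Pi.add_apply]
    · obtain ⟨p, hp⟩ := hfp U hU hg
      obtain ⟨p', hp'⟩ := hfp' U hU hg
      exact ⟨p + p', fun y hy => by simp only [hp y hy, hp' y hy, map_add]⟩
  | smul a c _ ih =>
    obtain ⟨f, hf, hfc, hfp⟩ := ih
    refine ⟨fun x => (a : ℝ) * f x, hf.const_mul _, fun m => ?_, fun U hU hg => ?_⟩
    · rw [mFourierCoeff_const_mul, hfc, Pi.smul_apply, Rat.smul_def, Complex.ofReal_ratCast]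
    · obtain ⟨p, hp⟩ := hfp U hU hg
      exact ⟨a • p, fun y hy => by simp only [hp y hy, map_smul, Rat.smul_def]⟩

end Main

open scoped Classical

/-! ### The coroot lattice, integral coordinates and invariance of the arrangement. -/

section Lattice

variable {ι M N : Type*} [AddCommGroup M] [Module ℝ M] [AddCommGroup N] [Module ℝ N]
  {P : RootPairing ι ℝ M N}

lemma root_smul (w : P.Aut) (i : ι) : P.root (w • i) = w • P.root i :=
  (RootPairing.Hom.root_weightMap_apply P P i w.toHom).symm

lemma act_one (y : N) : act (1 : P.Aut) y = y := by
  rw [act, LinearEquiv.symm_apply_eq]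
  rfl

lemma act_mul (v w : P.Aut) (y : N) : act (v * w) y = act v (act w y) := by
  rw [act, LinearEquiv.symm_apply_eq]
  change y = RootPairing.Equiv.coweightEquiv P P w (RootPairing.Equiv.coweightEquiv P P v _)
  simp only [act, LinearEquiv.apply_symm_apply]

lemma act_inv_act (w : P.Aut) (y : N) : act w⁻¹ (act w y) = y := by
  rw [← act_mul, inv_mul_cancel, act_one]

lemma act_act_inv (w : P.Aut) (y : N) : act w (act w⁻¹ y) = y := by
  rw [← act_mul, mul_inv_cancel, act_one]

lemma act_coroot (w : P.Aut) (i : ι) : act w (P.coroot i) = P.coroot (w • i) := by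
  rw [act, LinearEquiv.symm_apply_eq, RootPairing.Equiv.coweightEquiv_apply,
    RootPairing.Hom.coroot_coweightMap_apply]
  exact congrArg _ (w.indexEquiv.symm_apply_apply i).symm

variable (b : P.Base)

lemma coroot_mem_corootLattice (i : ι) : P.coroot i ∈ corootLattice b := b.coroot_mem_span_int i

lemma act_mem_corootLattice (w : P.Aut) {q : N} (hq : q ∈ corootLattice b) :
    act w q ∈ corootLattice b := by
  induction hq using Submodule.span_induction with
  | mem x hx =>
    obtain ⟨i, -, rfl⟩ := hx
    rw [act_coroot]
    exact coroot_mem_corootLattice b _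
  | zero => simp
  | add x y _ _ hx hy => rw [map_add]; exact add_mem hx hy
  | smul a x _ hx => rw [map_zsmul]; exact Submodule.smul_mem _ _ hx

variable [P.IsRootSystem]

/-- The coordinates `y ↦ (yᵢ)` as a linear equivalence. -/
def coordEquiv : N ≃ₗ[ℝ] (b.support → ℝ) := b.toCoweightBasis.equivFun

lemma coordEquiv_apply (y : N) : coordEquiv b y = coord b y := rfl

lemma coord_add (y z : N) (i : b.support) : coord b (y + z) i = coord b y i + coord b z i := by
  simp [coord]

lemma coord_sub (y z : N) (i : b.support) : coord b (y - z) i = coord b y i - coord b z i := by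
  simp [coord]

lemma coord_smul (c : ℝ) (y : N) (i : b.support) : coord b (c • y) i = c * coord b y i := by
  simp [coord]

lemma coord_injective : Function.Injective (coord b) := (coordEquiv b).injective

lemma coord_simple (i j : b.support) : coord b (P.coroot i) j = if i = j then 1 else 0 := by
  simp [coord, Finsupp.single_apply]

lemma coord_sum_smul (c : b.support → ℝ) (i : b.support) :
    coord b (∑ j, c j • P.coroot j) i = c i := by
  have : coordEquiv b (∑ j, c j • P.coroot j) i = c i := by
    rw [map_sum, Finset.sum_apply, Finset.sum_eq_single i]
    · rw [map_smul, Pi.smul_apply, coordEquiv_apply, coord_simple]; simp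
    · intro j _ hj
      rw [map_smul, Pi.smul_apply, coordEquiv_apply, coord_simple]; simp [hj]
    · simp
  exact this

lemma mem_corootLattice_iff {q : N} :
    q ∈ corootLattice b ↔ ∃ c : b.support → ℤ, ∀ i, coord b q i = c i := by
  constructor
  · intro hq
    induction hq using Submodule.span_induction with
    | mem x hx =>
      obtain ⟨j, hj, rfl⟩ := hx
      refine ⟨Pi.single ⟨j, hj⟩ 1, fun i => ?_⟩
      have := coord_simple b ⟨j, hj⟩ i
      rw [this, Pi.single_apply]
      simp [eq_comm]
    | zero => exact ⟨0, by simp [coord]⟩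
    | add x y _ _ hx hy =>
      obtain ⟨c, hc⟩ := hx
      obtain ⟨c', hc'⟩ := hy
      exact ⟨c + c', fun i => by rw [coord_add, hc, hc']; simp⟩
    | smul a x _ hx =>
      obtain ⟨c, hc⟩ := hx
      exact ⟨a • c, fun i => by
        rw [← Int.cast_smul_eq_zsmul ℝ, coord_smul, hc]; simp⟩
  · rintro ⟨c, hc⟩
    have : q = ∑ j, c j • P.coroot (j : b.support) := by
      apply coord_injective b
      ext i
      simp_rw [← Int.cast_smul_eq_zsmul ℝ]
      rw [coord_sum_smul, hc]
    rw [this]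
    exact Submodule.sum_mem _ fun j _ => Submodule.smul_mem _ _ (coroot_mem_corootLattice b _)

/-- The integral coordinates of a coroot. -/
def cvec (i : ι) : b.support → ℤ :=
  ((mem_corootLattice_iff b).1 (coroot_mem_corootLattice b i)).choose

lemma coord_coroot (i : ι) (j : b.support) : coord b (P.coroot i) j = cvec b i j :=
  ((mem_corootLattice_iff b).1 (coroot_mem_corootLattice b i)).choose_spec j

lemma cvec_simple (i j : b.support) : cvec b i j = if i = j then 1 else 0 := by
  have := coord_coroot b i j
  rw [coord_simple] at this
  split_ifs at this ⊢ <;> exact_mod_cast this.symm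

lemma add_mem_arrangement_iff {y q : N} (hq : q ∈ corootLattice b) :
    y + q ∈ arrangement b ↔ y ∈ arrangement b := by
  constructor
  · rintro ⟨R, h1, h2, p, hp, h3⟩
    exact ⟨R, h1, h2, p - q, sub_mem hp hq, by rwa [sub_sub_eq_add_sub]⟩
  · rintro ⟨R, h1, h2, p, hp, h3⟩
    exact ⟨R, h1, h2, p + q, add_mem hp hq, by rwa [add_sub_add_right_eq_sub]⟩

lemma act_mem_arrangement (w : P.Aut) {y : N} (hy : y ∈ arrangement b) :
    act w y ∈ arrangement b := by
  obtain ⟨R, h1, h2, q, hq, h3⟩ := hy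
  have hinj : Function.Injective fun i : ι => w • i := MulAction.injective w
  refine ⟨R.image (w • ·), ?_, ?_, act w q, act_mem_corootLattice b w hq, ?_⟩
  · rw [Finset.coe_image]
    refine LinearIndepOn.image_of_comp _ _ ?_
    have : P.root ∘ (fun i => w • i) = (RootPairing.Equiv.weightEquiv P P w).toLinearMap ∘ P.root :=
      funext fun i => root_smul w i
    rw [this]
    exact LinearIndependent.map' h1 _ (LinearEquiv.ker _)
  · rw [Finset.card_image_of_injective _ hinj, h2]
  · rw [← map_sub, Finset.coe_image, Set.image_image]
    have := Submodule.mem_map_of_mem (f := (act w).toLinearMap) h3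
    rw [Submodule.map_span, Set.image_image] at this
    simpa only [LinearEquiv.coe_coe, act_coroot] using this

lemma act_mem_arrangement_iff (w : P.Aut) {y : N} :
    act w y ∈ arrangement b ↔ y ∈ arrangement b :=
  ⟨fun h => by simpa [act_inv_act] using act_mem_arrangement b w⁻¹ h, act_mem_arrangement b w⟩

/-- Take for `R` the simple roots other than `i`. Thus off the arrangement no coordinate is an
integer, which confines cells and their images to open unit cubes. -/
lemma mem_arrangement_of_coord_eq {y : N} {i : b.support} {n : ℤ} (h : coord b y i = n) :
    y ∈ arrangement b := by
  refine ⟨b.support.erase i, b.linearIndepOn_root.mono (by simp), ?_, n • P.coroot i,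
    Submodule.smul_mem _ _ (coroot_mem_corootLattice b _), ?_⟩
  · rw [Finset.card_erase_of_mem i.2]
    have := Finset.card_pos.2 ⟨_, i.2⟩
    omega
  · have hy : y - n • P.coroot i = ∑ j ∈ Finset.univ.erase i, coord b y j • P.coroot j := by
      have h1 : y = ∑ j, coord b y j • P.coroot j := by
        apply coord_injective b
        ext j
        rw [coord_sum_smul]
      conv_lhs => rw [h1, ← Finset.add_sum_erase _ _ (Finset.mem_univ i), h,
        Int.cast_smul_eq_zsmul, add_sub_cancel_left]
    rw [hy]
    refine Submodule.sum_mem _ fun j hj => Submodule.smul_mem _ _ (Submodule.subset_span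
      ⟨j, ?_, rfl⟩)
    rw [Finset.mem_coe, Finset.mem_erase]
    exact ⟨fun h => Finset.ne_of_mem_erase hj (Subtype.ext h), j.2⟩

variable [Fintype ι] 

lemma generic_coord {y : N} (hy : y ∉ arrangement b) : Generic (cvec b) (coord b y) := by
  intro R hR hcard c hmem
  have hv : (fun j i => (cvec b j i : ℝ)) = coordEquiv b ∘ P.coroot := by
    ext j i
    exact (coord_coroot b j i).symm
  rw [hv] at hR hmem
  refine hy ⟨R, ?_, by simpa using hcard, ∑ j, c j • P.coroot (j : b.support),
    Submodule.sum_mem _ fun j _ => Submodule.smul_mem _ _ (coroot_mem_corootLattice b _), ?_⟩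
  · rw [← P.linearIndepOn_coroot_iff]
    exact LinearIndepOn.of_comp (coordEquiv b).toLinearMap hR
  · rw [Set.image_comp] at hmem
    have h1 : (fun i => coord b y i - (c i : ℝ)) =
        coordEquiv b (y - ∑ j, c j • P.coroot (j : b.support)) := by
      ext i
      rw [coordEquiv_apply, coord_sub]
      simp_rw [← Int.cast_smul_eq_zsmul ℝ]
      rw [coord_sum_smul]
    rw [h1] at hmem
    have h2 := Submodule.map_span (coordEquiv b).toLinearMap (P.coroot '' (R : Set ι))
    rw [LinearEquiv.coe_coe] at h2
    rw [← h2] at hmem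
    obtain ⟨z, hz, hz'⟩ := hmem
    rwa [← (coordEquiv b).injective hz']

end Lattice

/-! ### Cells of the parallelotope and the twisted action on them. -/

section Cells

variable {ι M N : Type*} [Fintype ι] [AddCommGroup M] [Module ℝ M] [AddCommGroup N] [Module ℝ N]
  [TopologicalSpace N] [IsTopologicalAddGroup N] [ContinuousSMul ℝ N] [T2Space N]
  {P : RootPairing ι ℝ M N} (b : P.Base) [P.IsRootSystem]

lemma finiteDimensional_coweight (b : P.Base) : FiniteDimensional ℝ N :=
  Module.Finite.of_basis b.toCoweightBasis

lemma continuous_linearMap (b : P.Base) {E : Type*} [AddCommGroup E] [Module ℝ E] [TopologicalSpace E]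
    [IsTopologicalAddGroup E] [ContinuousSMul ℝ E] (f : N →ₗ[ℝ] E) : Continuous f :=
  have := finiteDimensional_coweight b
  f.continuous_of_finiteDimensional

lemma continuous_coord : Continuous (coord b) :=
  continuous_linearMap b (coordEquiv b).toLinearMap

/-- The coordinates as a homeomorphism. -/
def coordHomeo : N ≃ₜ (b.support → ℝ) where
  toEquiv := (coordEquiv b).toEquiv
  continuous_toFun := continuous_coord b
  continuous_invFun := (coordEquiv b).symm.toLinearMap.continuous_of_finiteDimensional

lemma locallyConnectedSpace_coweight (b : P.Base) : LocallyConnectedSpace N :=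
  (coordHomeo b).isOpenEmbedding.locallyConnectedSpace

/-- A set of roots of cardinality `r - 1` is annihilated by an integral functional whose kernel is
spanned by the coroots. -/
lemma exists_functional {R : Finset ι} (h1 : LinearIndepOn ℝ P.root (R : Set ι))
    (h2 : R.card + 1 = b.support.card) :
    ∃ f : N →ₗ[ℝ] ℝ, (∀ q ∈ corootLattice b, ∃ n : ℤ, f q = n) ∧
      LinearMap.ker f = Submodule.span ℝ (P.coroot '' (R : Set ι)) := by
  -- The matrix has `r - 1` integer rows and `r` columns, so it kills a nonzero integer vector `m`;
  -- the functional is the pairing with `m`.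
  have hninj : ¬ Function.Injective
      (Matrix.of fun (j : R) (i : b.support) => cvec b j i).mulVecLin := fun h => by
    have := card_le_of_injective ℤ _ h
    simp only [Fintype.card_coe] at this
    omega
  rw [← LinearMap.ker_eq_bot, LinearMap.ker_eq_bot'] at hninj
  push Not at hninj
  obtain ⟨m, hm, hm0⟩ := hninj
  let f : N →ₗ[ℝ] ℝ := (Fintype.linearCombination ℝ (fun i => (m i : ℝ))) ∘ₗ
    (coordEquiv b).toLinearMap
  have hf : ∀ y, f y = ∑ i, coord b y i * m i := fun y => by
    simp [f, Fintype.linearCombination_apply, coordEquiv_apply]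
  have hfsimple : ∀ i : b.support, f (P.coroot i) = m i := fun i => by
    simp [hf, coord_simple]
  have hf0 : f ≠ 0 := fun h0 => hm0 (funext fun i => by
    have := hfsimple i
    rw [h0, LinearMap.zero_apply] at this
    exact_mod_cast this.symm)
  refine ⟨f, fun q hq => ?_, ?_⟩
  · obtain ⟨c, hc⟩ := (mem_corootLattice_iff b).1 hq
    exact ⟨∑ i, c i * m i, by simp [hf, hc]⟩
  · have := finiteDimensional_coweight b
    have hle : Submodule.span ℝ (P.coroot '' (R : Set ι)) ≤ LinearMap.ker f := by
      rw [Submodule.span_le]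
      rintro _ ⟨j, hj, rfl⟩
      have h := congrFun hm ⟨j, hj⟩
      simp only [Matrix.mulVecLin_apply, Matrix.mulVec, dotProduct, Matrix.of_apply,
        Pi.zero_apply] at h
      change f _ = 0
      rw [hf]
      simp_rw [coord_coroot]
      exact_mod_cast h
    refine (Submodule.eq_of_le_of_finrank_eq hle ?_).symm
    have h3 := Module.Dual.finrank_ker_add_one_of_ne_zero (f := f) hf0
    have h4 : Module.finrank ℝ N = b.support.card := by
      rw [Module.finrank_eq_card_basis b.toCoweightBasis, Fintype.card_coe]
    have h5 : Module.finrank ℝ (Submodule.span ℝ (P.coroot '' (R : Set ι))) = R.card := by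
      rw [← P.linearIndepOn_coroot_iff] at h1
      have := finrank_span_eq_card (linearIndependent_restrict_iff.2 h1)
      rw [Set.range_domRestrict] at this
      simpa using this
    omega

/-- For each of the finitely many `R`, all lattice translates of the hyperplane together form the
preimage of a set of integers under one functional, hence a closed set. -/
lemma isClosed_arrangement : IsClosed (arrangement b) := by
  have : arrangement b = ⋃ R ∈ {R : Finset ι | LinearIndepOn ℝ P.root (R : Set ι) ∧
      R.card + 1 = b.support.card}, {y | ∃ q ∈ corootLattice b,
        y - q ∈ Submodule.span ℝ (P.coroot '' (R : Set ι))} := by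
    ext y
    simp [arrangement, and_assoc]
  rw [this]
  refine (Set.toFinite _).isClosed_biUnion fun R ⟨h1, h2⟩ => ?_
  obtain ⟨f, hfq, hker⟩ := exists_functional b h1 h2
  have h : {y | ∃ q ∈ corootLattice b, y - q ∈ Submodule.span ℝ (P.coroot '' (R : Set ι))} =
      f ⁻¹' (Int.cast '' {n : ℤ | ∃ q ∈ corootLattice b, f q = n}) := by
    ext y
    simp only [← hker, LinearMap.mem_ker, map_sub, sub_eq_zero, Set.mem_ofPred_eq, Set.mem_preimage,
      Set.mem_image]
    constructor
    · rintro ⟨q, hq, h⟩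
      obtain ⟨n, hn⟩ := hfq q hq
      exact ⟨n, ⟨q, hq, hn⟩, by rw [h, hn]⟩
    · rintro ⟨n, ⟨q, hq, hn⟩, h⟩
      exact ⟨q, hq, by rw [← h, hn]⟩
  rw [h]
  exact (Int.isClosedEmbedding_coe_real.isClosedMap _ (isClosed_discrete _)).preimage
    (continuous_linearMap b f)

lemma coord_mem_Ioo {y : N} (hy : y ∈ parallelotope b \ arrangement b) (i : b.support) :
    0 < coord b y i ∧ coord b y i < 1 := by
  refine ⟨lt_of_le_of_ne (hy.1 i).1 fun h => hy.2 ?_, lt_of_le_of_ne (hy.1 i).2 fun h => hy.2 ?_⟩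
  · exact mem_arrangement_of_coord_eq b (i := i) (n := 0) (by simp [← h])
  · exact mem_arrangement_of_coord_eq b (i := i) (n := 1) (by simp [h])

lemma isOpen_parallelotope_diff : IsOpen (parallelotope b \ arrangement b) := by
  have : parallelotope b \ arrangement b =
      (coord b ⁻¹' Set.pi Set.univ fun _ => Set.Ioo 0 1) ∩ (arrangement b)ᶜ := by
    ext y
    constructor
    · exact fun hy => ⟨fun i _ => coord_mem_Ioo b hy i, hy.2⟩
    · exact fun hy => ⟨fun i => ⟨(hy.1 i trivial).1.le, (hy.1 i trivial).2.le⟩, hy.2⟩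
  rw [this]
  exact ((isOpen_set_pi Set.finite_univ fun _ _ => isOpen_Ioo).preimage (continuous_coord b)).inter
    (isClosed_arrangement b).isOpen_compl

variable {b}

lemma Cell.isOpen (ν : Cell b) : IsOpen ν.1 := by
  obtain ⟨D, y, hy, rfl⟩ := ν
  have := locallyConnectedSpace_coweight b
  exact (isOpen_parallelotope_diff b).connectedComponentIn

lemma Cell.subset (ν : Cell b) : ν.1 ⊆ parallelotope b \ arrangement b := by
  obtain ⟨D, y, hy, rfl⟩ := ν
  exact connectedComponentIn_subset _ _

lemma Cell.isPreconnected (ν : Cell b) : IsPreconnected ν.1 := by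
  obtain ⟨D, y, hy, rfl⟩ := ν
  exact isPreconnected_connectedComponentIn

lemma Cell.nonempty (ν : Cell b) : ν.1.Nonempty := by
  obtain ⟨D, y, hy, rfl⟩ := ν
  exact ⟨y, mem_connectedComponentIn hy⟩

lemma Cell.eq_connectedComponentIn (ν : Cell b) {y : N} (hy : y ∈ ν.1) :
    ν.1 = connectedComponentIn (parallelotope b \ arrangement b) y := by
  obtain ⟨D, z, hz, rfl⟩ := ν
  exact connectedComponentIn_eq hy

lemma Cell.eq_of_mem {ν κ : Cell b} {y : N} (hν : y ∈ ν.1) (hκ : y ∈ κ.1) : ν = κ :=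
  Subtype.ext ((ν.eq_connectedComponentIn hν).trans (κ.eq_connectedComponentIn hκ).symm)

/-- The cell of a point. -/
def cellOf {y : N} (hy : y ∈ parallelotope b \ arrangement b) : Cell b :=
  ⟨connectedComponentIn (parallelotope b \ arrangement b) y, y, hy, rfl⟩

lemma mem_cellOf {y : N} (hy : y ∈ parallelotope b \ arrangement b) : y ∈ (cellOf hy).1 :=
  mem_connectedComponentIn hy

lemma continuous_move (b : P.Base) (w : P.Aut) (q : N) : Continuous fun y => act w y + q :=
  (continuous_linearMap b (act w).toLinearMap).add continuous_const

lemma move_notMem_arrangement {w : P.Aut} {q : N} (hq : q ∈ corootLattice b) {y : N}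
    (hy : y ∉ arrangement b) : act w y + q ∉ arrangement b := by
  rwa [add_mem_arrangement_iff b hq, act_mem_arrangement_iff]

/-- The image is connected and avoids the arrangement. The floors of its coordinates are constant,
so one point in the parallelotope forces the whole image into it. -/
lemma image_move_subset {w : P.Aut} {q : N} (hq : q ∈ corootLattice b) {ν : Cell b} {y : N}
    (hy : y ∈ ν.1) (hy' : act w y + q ∈ parallelotope b \ arrangement b) :
    (fun y => act w y + q) '' ν.1 ⊆ (cellOf hy').1 := by
  refine (ν.isPreconnected.image _ (continuous_move b w q).continuousOn)
    |>.subset_connectedComponentIn ⟨y, hy, rfl⟩ ?_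
  rintro _ ⟨z, hz, rfl⟩
  have hz' := move_notMem_arrangement (w := w) hq (ν.subset hz).2
  refine ⟨fun i => ?_, hz'⟩
  have hfl : ⌊coord b (act w z + q) i⌋ = ⌊coord b (act w y + q) i⌋ := by
    refine floor_eq_of_isPreconnected (t := fun z => coord b (act w z + q) i) ν.isPreconnected
      ?_ (fun x hx n h => ?_) hz hy
    · exact (((continuous_apply i).comp (continuous_coord b)).comp
        (continuous_move b w q)).continuousOn
    · exact move_notMem_arrangement (w := w) hq (ν.subset hx).2 (mem_arrangement_of_coord_eq b h)
  have h0 := coord_mem_Ioo b hy' i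
  rw [Int.floor_eq_zero_iff.2 ⟨h0.1.le, h0.2⟩, Int.floor_eq_zero_iff] at hfl
  exact ⟨hfl.1, hfl.2.le⟩

lemma image_move_eq {w : P.Aut} {q : N} (hq : q ∈ corootLattice b) {ν : Cell b} {y : N}
    (hy : y ∈ ν.1) (hy' : act w y + q ∈ parallelotope b \ arrangement b) :
    (fun y => act w y + q) '' ν.1 = (cellOf hy').1 := by
  refine (image_move_subset hq hy hy').antisymm fun z hz => ?_
  have hq' : -act w⁻¹ q ∈ corootLattice b := neg_mem (act_mem_corootLattice b w⁻¹ hq)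
  have hinv : ∀ x, act w⁻¹ (act w x + q) + -act w⁻¹ q = x := fun x => by
    rw [map_add, act_inv_act, add_neg_cancel_right]
  have hy'' : act w⁻¹ (act w y + q) + -act w⁻¹ q ∈ parallelotope b \ arrangement b := by
    rw [hinv]; exact ν.subset hy
  have h := image_move_subset hq' (mem_cellOf hy') hy'' ⟨z, hz, rfl⟩
  have hν : cellOf hy'' = ν := Cell.eq_of_mem (mem_cellOf hy'') (by rw [hinv]; exact hy)
  rw [hν] at h
  refine ⟨_, h, ?_⟩
  simp only [map_add, map_neg, act_act_inv]
  abel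

lemma exists_move (w : P.Aut) (ν : Cell b) : ∃ q ∈ corootLattice b, ∃ κ : Cell b,
    (fun y => act w y + q) '' ν.1 = κ.1 := by
  obtain ⟨y, hy⟩ := ν.nonempty
  -- Subtracting the floors of the coordinates of one moved point brings that point into the unit
  -- cube.
  let q : N := ∑ i, ((-⌊coord b (act w y) i⌋ : ℤ) : ℝ) • P.coroot (i : b.support)
  have hqc : ∀ i, coord b q i = ((-⌊coord b (act w y) i⌋ : ℤ) : ℝ) := coord_sum_smul b _
  have hq : q ∈ corootLattice b := (mem_corootLattice_iff b).2 ⟨_, hqc⟩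
  refine ⟨q, hq, cellOf ⟨fun i => ?_, move_notMem_arrangement hq (ν.subset hy).2⟩,
    image_move_eq hq hy _⟩
  rw [coord_add, hqc]
  push_cast
  have h1 := Int.floor_le (coord b (act w y) i)
  have h2 := Int.lt_floor_add_one (coord b (act w y) i)
  constructor <;> linarith

/-- Two lattice translations that take one point into the open unit cube differ by integer
coordinates of absolute value less than `1`. -/
lemma move_unique {w : P.Aut} {ν κ κ' : Cell b} {q q' : N} (hq : q ∈ corootLattice b)
    (hq' : q' ∈ corootLattice b) (h : (fun y => act w y + q) '' ν.1 = κ.1)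
    (h' : (fun y => act w y + q') '' ν.1 = κ'.1) : q' = q ∧ κ' = κ := by
  obtain ⟨y, hy⟩ := ν.nonempty
  have hy1 : act w y + q ∈ κ.1 := h ▸ ⟨y, hy, rfl⟩
  have hy2 : act w y + q' ∈ κ'.1 := h' ▸ ⟨y, hy, rfl⟩
  have hqq : q' = q := by
    obtain ⟨c, hc⟩ := (mem_corootLattice_iff b).1 hq
    obtain ⟨c', hc'⟩ := (mem_corootLattice_iff b).1 hq'
    apply coord_injective b
    ext i
    have h1 := coord_mem_Ioo b (κ.subset hy1) i
    have h2 := coord_mem_Ioo b (κ'.subset hy2) i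
    rw [coord_add, hc] at h1
    rw [coord_add, hc'] at h2
    rw [hc, hc']
    have h3 : ((c' i - c i : ℤ) : ℝ) < 1 := by push_cast; linarith
    have h4 : (-1 : ℝ) < ((c' i - c i : ℤ) : ℝ) := by push_cast; linarith
    have h5 : c' i - c i < 1 := by exact_mod_cast h3
    have h6 : -1 < c' i - c i := by exact_mod_cast h4
    have : c' i = c i := by omega
    rw [this]
  subst hqq
  exact ⟨rfl, Cell.eq_of_mem hy2 hy1⟩

/-- The translation that brings the image of a cell back to the parallelotope. -/
def shift (w : P.Aut) (ν : Cell b) : N := (exists_move w ν).choose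

lemma shift_mem (w : P.Aut) (ν : Cell b) : shift w ν ∈ corootLattice b :=
  (exists_move w ν).choose_spec.1

lemma act_zero_move : (fun y : N => act (1 : P.Aut) y + 0) = id := by
  ext y; rw [act_one, add_zero, id]

/-- Composing two moves is again a move by a lattice vector. Together with `move_unique` this gives
the action laws and the cocycle identity of `shift`. -/
lemma move_move {v w : P.Aut} {p q : N} {ν κ μ : Cell b}
    (h : (fun y => act w y + q) '' ν.1 = κ.1) (h' : (fun y => act v y + p) '' κ.1 = μ.1) :
    (fun y => act (v * w) y + (p + act v q)) '' ν.1 = μ.1 := by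
  rw [← h', ← h, Set.image_image]
  congr 1
  ext y
  rw [act_mul, map_add]
  abel

variable (b) in
/-- The action of the automorphism group on the cells. -/
@[reducible] def cellAction : MulAction P.Aut (Cell b) where
  smul w ν := (exists_move w ν).choose_spec.2.choose
  one_smul ν := by
    have h := (exists_move (1 : P.Aut) ν).choose_spec
    refine (move_unique (zero_mem _) h.1 (w := 1) (ν := ν) ?_ h.2.choose_spec).2
    rw [act_zero_move, Set.image_id]
  mul_smul v w ν := by
    have h := (exists_move (v * w) ν).choose_spec
    have hw := (exists_move w ν).choose_spec
    have hv := (exists_move v hw.2.choose).choose_spec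
    exact (move_unique (add_mem hv.1 (act_mem_corootLattice b v hw.1)) h.1
      (move_move hw.2.choose_spec hv.2.choose_spec) h.2.choose_spec).2

attribute [local instance] cellAction

lemma image_shift (w : P.Aut) (ν : Cell b) :
    (fun y => act w y + shift w ν) '' ν.1 = (w • ν).1 :=
  (exists_move w ν).choose_spec.2.choose_spec

lemma shift_unique (w : P.Aut) (ν : Cell b) (q' : N) (hq' : q' ∈ corootLattice b) (κ : Cell b)
    (h : (fun y => act w y + q') '' ν.1 = κ.1) : q' = shift w ν ∧ κ = w • ν :=
  move_unique (shift_mem w ν) hq' (image_shift w ν) h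

lemma shift_mul (v w : P.Aut) (ν : Cell b) :
    shift v (w • ν) + act v (shift w ν) = shift (v * w) ν :=
  (shift_unique (v * w) ν _ (add_mem (shift_mem _ _) (act_mem_corootLattice b v (shift_mem _ _))) _
    (move_move (image_shift w ν) (image_shift v (w • ν)))).1

lemma shift_one (ν : Cell b) : shift (1 : P.Aut) ν = 0 :=
  ((shift_unique 1 ν 0 (zero_mem _) ν (by rw [act_zero_move, Set.image_id])).1).symm

end Cells

attribute [local instance] cellAction

/-! ### The periodic function on the torus and its polynomial continuations. -/

section Periodic

variable {ι M N : Type*} [Fintype ι] [AddCommGroup M] [Module ℝ M] [AddCommGroup N] [Module ℝ N]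
  {P : RootPairing ι ℝ M N} (b : P.Base) [P.IsRootSystem]

/-- The coordinates of the positive roots that are not simple. -/
def nonsimpleMatrix : Matrix b.support {i : ι // b.IsPos i ∧ i ∉ b.support} ℤ :=
  Matrix.of fun i j => cvec b j i

/-- The periodic function `P(k, y; Δ)` as a function on the torus. -/
def torusPeriodic (k : Exponent P) : UnitAddTorus b.support → ℝ :=
  convBernoulli (nonsimpleMatrix b) (fun j => k.1 j.1) (fun i => k.1 i.1)

lemma periodic_eq (k : Exponent P) (y : N) :
    periodic b k y = torusPeriodic b k (toTorus (coord b y)) := by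
  rw [torusPeriodic, convBernoulli_toTorus, periodic]
  simp only [coord_coroot, nonsimpleMatrix, Matrix.of_apply]

lemma bddMeas_torusPeriodic (k : Exponent P) : BddMeas (torusPeriodic b k) :=
  bddMeas_convBernoulli _ _ _

/-- The positive roots. -/
def posRoots : Finset ι := Finset.univ.filter b.IsPos

lemma mem_posRoots {i : ι} : i ∈ posRoots b ↔ b.IsPos i := by simp [posRoots]

/-- The simple coroots are the coordinate vectors, so the factors at `m i` and those at `m A`
combine into one product over all positive roots. -/
lemma mFourierCoeff_torusPeriodic (k : Exponent P) (m : b.support → ℤ) :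
    mFourierCoeff (fun Y => (torusPeriodic b k Y : ℂ)) m = coef (cvec b) k.1 (posRoots b) m := by
  have h1 : ∏ j : {i : ι // b.IsPos i ∧ i ∉ b.support},
      bernoulliFourierCoeff (k.1 j) (Matrix.vecMul m (nonsimpleMatrix b) j) =
      ∏ j ∈ (posRoots b).filter (· ∉ b.support), bernoulliFourierCoeff (k.1 j) (cvec b j ⬝ᵥ m) := by
    rw [Finset.prod_subtype ((posRoots b).filter (· ∉ b.support))
      (p := fun i => b.IsPos i ∧ i ∉ b.support) (by simp [mem_posRoots])]
    refine Finset.prod_congr rfl fun j _ => ?_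
    congr 1
    exact dotProduct_comm _ _
  have h2 : ∏ i : b.support, bernoulliFourierCoeff (k.1 i) (m i) =
      ∏ j ∈ (posRoots b).filter (· ∈ b.support), bernoulliFourierCoeff (k.1 j) (cvec b j ⬝ᵥ m) := by
    rw [Finset.prod_subtype ((posRoots b).filter (· ∈ b.support)) (p := (· ∈ b.support))
      (by simpa [mem_posRoots] using fun x hx => b.isPos_of_mem_support hx)]
    refine Finset.prod_congr rfl fun j _ => ?_
    congr 1
    simp [dotProduct, cvec_simple]
  rw [torusPeriodic, mFourierCoeff_convBernoulli, h1, h2, mul_comm, coef,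
    Finset.prod_filter_mul_prod_filter_not]

lemma nonDeg_posRoots : NonDeg (cvec b) (posRoots b) := by
  intro m hm
  ext i
  have := hm i ((mem_posRoots b).2 (b.isPos_of_mem_support i.2))
  simpa [dotProduct, cvec_simple] using this

lemma periodic_add (k : Exponent P) (y : N) {q : N} (hq : q ∈ corootLattice b) :
    periodic b k (y + q) = periodic b k y := by
  rw [periodic_eq, periodic_eq]
  congr 1
  ext i
  obtain ⟨c, hc⟩ := (mem_corootLattice_iff b).1 hq
  rw [toTorus, toTorus, coord_add, hc, AddCircle.coe_add, add_eq_left,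
    AddCircle.coe_eq_zero_iff]
  exact ⟨c i, by simp⟩

variable [TopologicalSpace N] [IsTopologicalAddGroup N] [ContinuousSMul ℝ N] [T2Space N]

lemma continuousAt_periodic (k : Exponent P) {y : N} (hy : y ∉ arrangement b) :
    ContinuousAt (periodic b k) y := by
  have h : periodic b k = torusPeriodic b k ∘ fun y => toTorus (coord b y) :=
    funext (periodic_eq b k)
  rw [h]
  refine ContinuousAt.comp (g := torusPeriodic b k) ?_
    (continuous_toTorus.comp (continuous_coord b)).continuousAt
  refine continuousAt_convBernoulli _ _ _ fun i hi => (hy ?_).elim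
  obtain ⟨n, hn⟩ := (AddCircle.coe_eq_zero_iff 1).1 hi
  exact mem_arrangement_of_coord_eq b (n := n) (by simpa using hn.symm)

/-- Functions on the torus that agree almost everywhere induce functions that agree on each cell
if they are continuous there. -/
lemma eqOn_cell_of_ae {f g : UnitAddTorus b.support → ℝ} (h : f =ᵐ[volume] g) (ν : Cell b)
    (hf : ContinuousOn (fun y => f (toTorus (coord b y))) ν.1)
    (hg : ContinuousOn (fun y => g (toTorus (coord b y))) ν.1) {y : N} (hy : y ∈ ν.1) :
    f (toTorus (coord b y)) = g (toTorus (coord b y)) := by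
  let e := coordHomeo b
  have hU : IsOpen (e '' ν.1) := e.isOpenMap _ ν.isOpen
  have hsub : e '' ν.1 ⊆ Set.pi Set.univ fun _ => Set.Ioo 0 1 := by
    rintro _ ⟨z, hz, rfl⟩ i -
    exact coord_mem_Ioo b (ν.subset hz) i
  have key : ∀ {u : UnitAddTorus b.support → ℝ},
      ContinuousOn (fun y => u (toTorus (coord b y))) ν.1 →
      ContinuousOn (fun x => u (toTorus x)) (e '' ν.1) := by
    intro u hu
    have h1 := hu.comp (e.symm.continuous.continuousOn (s := e '' ν.1)) (by
      rintro _ ⟨z, hz, rfl⟩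
      simpa using hz)
    refine h1.congr fun x _ => ?_
    have : coord b (e.symm x) = x := e.apply_symm_apply x
    simp only [Function.comp_apply, this]
  exact Measure.eqOn_open_of_ae_eq (μ := (volume : Measure (b.support → ℝ)))
    (ae_restrict_of_ae_restrict_of_subset hsub
      (ae_toTorus (p := fun Y => f Y = g Y) h)) hU (key hf) (key hg) ⟨y, hy, rfl⟩

variable {b}

/-- The function built from Fourier coefficients agrees with the periodic function almost
everywhere, and both are continuous on the cell. -/
lemma exists_continues (k : Exponent P) (ν : Cell b) : ∃ p, Continues b k ν p := by
  obtain ⟨f, hf, hfc, hfp⟩ := exists_function_of_mem_basisSpan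
    (coef_mem_basisSpan (nonDeg_posRoots b) k.1)
  have hae : torusPeriodic b k =ᵐ[volume] f :=
    (bddMeas_torusPeriodic b k).ae_eq hf fun m => by rw [hfc, mFourierCoeff_torusPeriodic]
  obtain ⟨p, hp⟩ := hfp (coord b '' ν.1)
    (ν.isPreconnected.image _ (continuous_coord b).continuousOn) (by
      rintro _ ⟨y, hy, rfl⟩
      exact generic_coord b (ν.subset hy).2)
  refine ⟨p, fun y hy => ?_⟩
  rw [periodic_eq, eqOn_cell_of_ae b hae ν ?_ ?_ hy, hp _ ⟨y, hy, rfl⟩]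
  · intro z hz
    have := (continuousAt_periodic b k (ν.subset hz).2).continuousWithinAt (s := ν.1)
    exact this.congr (fun x _ => (periodic_eq b k x).symm) (periodic_eq b k z).symm
  · have : Continuous fun x : b.support → ℝ => MvPolynomial.aeval x p := by
      simp only [MvPolynomial.aeval_def, MvPolynomial.eval₂_eq]
      fun_prop
    refine (this.comp (continuous_coord b)).continuousOn.congr fun z hz => ?_
    exact hp _ ⟨z, hz, rfl⟩

/-- A rational polynomial in the coordinates is determined by its values on a cell. -/
lemma eq_of_eqOn_cell (ν : Cell b) {p p' : MvPolynomial b.support ℚ}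
    (h : ∀ y ∈ ν.1, MvPolynomial.aeval (coord b y) p = MvPolynomial.aeval (coord b y) p') :
    p = p' := by
  obtain ⟨y, hy⟩ := ν.nonempty
  let e := coordHomeo b
  have hU : IsOpen (e '' ν.1) := e.isOpenMap _ ν.isOpen
  obtain ⟨ε, hε, hball⟩ := Metric.isOpen_iff.1 hU (e y) ⟨y, hy, rfl⟩
  apply MvPolynomial.map_injective (algebraMap ℚ ℝ) (algebraMap ℚ ℝ).injective
  -- A ball in the sup metric is a product of intervals, and polynomials agreeing on a product of
  -- infinite sets are equal.
  refine MvPolynomial.funext_set (fun i => Set.Ioo (e y i - ε) (e y i + ε))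
    (fun i => Set.Ioo_infinite (by linarith)) fun x hx => ?_
  obtain ⟨z, hz, rfl⟩ := hball (show x ∈ Metric.ball (e y) ε by
    rw [ball_pi _ hε]
    intro i _
    change x i ∈ Metric.ball (e y i) ε
    rw [Real.ball_eq_Ioo]
    exact hx i trivial)
  have := h z hz
  rw [MvPolynomial.aeval_def, MvPolynomial.aeval_def, ← MvPolynomial.eval_map,
    ← MvPolynomial.eval_map] at this
  exact this

lemma continues_bernoulliPoly (k : Exponent P) (ν : Cell b) :
    Continues b k ν (bernoulliPoly b k ν) :=
  Classical.epsilon_spec (exists_continues k ν)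

lemma eq_bernoulliPoly {k : Exponent P} {ν : Cell b} {p : MvPolynomial b.support ℚ}
    (hp : Continues b k ν p) : p = bernoulliPoly b k ν :=
  eq_of_eqOn_cell ν fun y hy => (hp y hy).trans (continues_bernoulliPoly k ν y hy).symm

end Periodic

/-! ### Behaviour of the periodic function under automorphisms. -/

section Transformation

variable {ι M N : Type*} [Fintype ι] [AddCommGroup M] [Module ℝ M] [AddCommGroup N] [Module ℝ N]
  {P : RootPairing ι ℝ M N} (b : P.Base) [P.IsRootSystem]

/-- The integer matrix of an automorphism in the basis of simple coroots. -/
def autMatrix (w : P.Aut) : Matrix b.support b.support ℤ := Matrix.of fun i j => cvec b (w • j.1) i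

lemma coord_act (w : P.Aut) (y : N) (i : b.support) :
    coord b (act w y) i = ∑ j, (autMatrix b w i j : ℝ) * coord b y j := by
  have h1 : y = ∑ j, coord b y j • P.coroot (j : b.support) := by
    apply coord_injective b
    ext j
    rw [coord_sum_smul]
  have h2 : coordEquiv b (act w y) i = ∑ j, (autMatrix b w i j : ℝ) * coord b y j := by
    conv_lhs => rw [h1]
    simp only [map_sum, map_smul, Finset.sum_apply, Pi.smul_apply, act_coroot, coordEquiv_apply,
      coord_coroot, smul_eq_mul, mul_comm, autMatrix, Matrix.of_apply]
  exact h2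

lemma toTorus_coord_act (w : P.Aut) (y : N) :
    toTorus (coord b (act w y)) = torusMap (autMatrix b w) (toTorus (coord b y)) := by
  ext i
  simp only [toTorus, torusMap_apply, coord_act]
  rw [← QuotientAddGroup.mk'_apply, map_sum]
  refine Finset.sum_congr rfl fun j _ => ?_
  rw [← zsmul_eq_mul, map_zsmul]
  rfl

lemma autMatrix_mul (v w : P.Aut) : autMatrix b v * autMatrix b w = autMatrix b (v * w) := by
  ext i j
  have h1 : coord b (act (v * w) (P.coroot j)) i = autMatrix b (v * w) i j := by
    rw [act_coroot, coord_coroot]; rfl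
  rw [act_mul, coord_act] at h1
  have h2 : ∀ l, coord b (act w (P.coroot j)) l = autMatrix b w l j := fun l => by
    rw [act_coroot, coord_coroot]; rfl
  simp_rw [h2] at h1
  rw [Matrix.mul_apply]
  exact_mod_cast h1

lemma autMatrix_one : autMatrix b 1 = 1 := by
  ext i j
  rw [autMatrix, Matrix.of_apply, one_smul, cvec_simple, Matrix.one_apply]
  simp [eq_comm]

lemma cvec_smul (w : P.Aut) (i : ι) (j : b.support) :
    cvec b (w • i) j = ∑ l, autMatrix b w j l * cvec b i l := by
  have h := coord_act b w (P.coroot i) j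
  rw [act_coroot] at h
  simp_rw [coord_coroot] at h
  exact_mod_cast h

lemma exponent_smul_apply (w : P.Aut) (k : Exponent P) (i : ι) : (w • k).1 i = k.1 (w⁻¹ • i) := rfl

/-- The positive one among a root and its negative. -/
def absRoot (i : ι) : ι := if b.IsPos i then i else P.reflectionPerm i i

lemma coroot_reflectionPerm_self (i : ι) : P.coroot (P.reflectionPerm i i) = -P.coroot i := by
  simp

lemma isPos_reflectionPerm_self {i : ι} : b.IsPos (P.reflectionPerm i i) ↔ ¬ b.IsPos i :=
  RootPairing.Base.IsPos.neg_iff_not b i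

lemma isPos_absRoot (i : ι) : b.IsPos (absRoot b i) := by
  rw [absRoot]
  split_ifs with h
  · exact h
  · exact (isPos_reflectionPerm_self b).2 h

lemma smul_reflectionPerm_self (w : P.Aut) (i : ι) :
    w • P.reflectionPerm i i = P.reflectionPerm (w • i) (w • i) := by
  apply P.root.injective
  rw [root_smul, P.root_reflectionPerm, P.root_reflectionPerm, P.reflection_apply_self,
    P.reflection_apply_self, root_smul, smul_neg]

/-- This expresses that the group acts on roots modulo sign, with positive roots as representatives.
-/
lemma absRoot_smul_absRoot (w : P.Aut) (i : ι) :
    absRoot b (w • absRoot b i) = absRoot b (w • i) := by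
  by_cases h : b.IsPos i
  · simp [absRoot, h]
  have h1 : absRoot b i = P.reflectionPerm i i := by simp [absRoot, h]
  have h3 : ∀ j, P.reflectionPerm (P.reflectionPerm j j) (P.reflectionPerm j j) = j := fun j =>
    P.root.injective (by
      rw [P.root_reflectionPerm, P.reflection_apply_self, P.root_reflectionPerm,
        P.reflection_apply_self, neg_neg])
  rw [h1, smul_reflectionPerm_self]
  by_cases h2 : b.IsPos (w • i)
  · rw [absRoot, if_neg (by rw [isPos_reflectionPerm_self]; exact not_not.2 h2), h3, absRoot,
      if_pos h2]
  · simp [absRoot, isPos_reflectionPerm_self, h2]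

lemma absRoot_of_isPos {i : ι} (h : b.IsPos i) : absRoot b i = i := by simp [absRoot, h]

lemma cvec_reflectionPerm_self (i : ι) : cvec b (P.reflectionPerm i i) = -cvec b i := by
  ext j
  have h1 := coord_coroot b (P.reflectionPerm i i) j
  have h2 : coord b (-P.coroot i) j = -coord b (P.coroot i) j := by simp [coord]
  rw [coroot_reflectionPerm_self, h2, coord_coroot] at h1
  rw [Pi.neg_apply]
  exact_mod_cast h1.symm

lemma sign_eq (w : P.Aut) (k : Exponent P) :
    (sign b w k : ℂ) = ∏ i ∈ posRoots b, if b.IsPos (w • i) then 1 else (-1 : ℂ) ^ k.1 i := by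
  have h : sign b w k = ∏ i ∈ (posRoots b).filter (fun i => ¬ b.IsPos (w • i)), (-1 : ℚ) ^ k.1 i := by
    rw [Finset.prod_subtype ((posRoots b).filter (fun i => ¬ b.IsPos (w • i)))
      (p := fun i => b.IsPos i ∧ ¬ b.IsPos (w • i)) (by simp [mem_posRoots])]
    rw [sign]
    refine Finset.prod_congr rfl fun i _ => ?_
    rw [zpow_neg, zpow_natCast, ← inv_pow, inv_neg, inv_one]
  rw [h, Finset.prod_filter]
  push_cast
  refine Finset.prod_congr rfl fun i _ => ?_
  split_ifs <;> simp_all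

/-- The Fourier coefficients of `P(k, y; Δ)` transform by the sign under automorphisms. -/
lemma coef_smul (w : P.Aut) (k : Exponent P) (m : b.support → ℤ) :
    coef (cvec b) (w • k).1 (posRoots b) m =
      sign b w k * coef (cvec b) k.1 (posRoots b) (Matrix.vecMul m (autMatrix b w)) := by
  rw [sign_eq, coef, coef, ← Finset.prod_mul_distrib]
  symm
  -- The factor at `i` matches the factor at whichever of `±w i` is positive; the sign appears
  -- exactly when this is `-w i`.
  refine Finset.prod_bij' (fun i _ => absRoot b (w • i)) (fun i _ => absRoot b (w⁻¹ • i))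
    (fun i _ => (mem_posRoots b).2 (isPos_absRoot b _))
    (fun i _ => (mem_posRoots b).2 (isPos_absRoot b _)) ?_ ?_ ?_
  · intro i hi
    rw [absRoot_smul_absRoot, inv_smul_smul, absRoot_of_isPos b ((mem_posRoots b).1 hi)]
  · intro i hi
    rw [absRoot_smul_absRoot, smul_inv_smul, absRoot_of_isPos b ((mem_posRoots b).1 hi)]
  · intro i hi
    have hdot : cvec b i ⬝ᵥ Matrix.vecMul m (autMatrix b w) = cvec b (w • i) ⬝ᵥ m := by
      have : cvec b (w • i) = Matrix.mulVec (autMatrix b w) (cvec b i) :=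
        funext fun j => cvec_smul b w i j
      rw [this, dotProduct_comm, dotProduct_comm _ m, Matrix.dotProduct_mulVec]
    rw [hdot, exponent_smul_apply]
    by_cases h : b.IsPos (w • i)
    · rw [absRoot_of_isPos b h, if_pos h, one_mul, inv_smul_smul]
    · have h1 : absRoot b (w • i) = P.reflectionPerm (w • i) (w • i) := by simp [absRoot, h]
      have h2 : k.1 (P.reflectionPerm i i) = k.1 i := k.2 i _ (by simp)
      rw [h1, if_neg h, smul_reflectionPerm_self, inv_smul_smul, h2, cvec_reflectionPerm_self,
        neg_dotProduct, bernoulliFourierCoeff_neg]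

/-- Pulling back along the matrix of `w` moves the Fourier coefficient at `m` to `n = m w⁻¹`, where
`coef_smul` applies. -/
lemma torusPeriodic_smul_ae (w : P.Aut) (k : Exponent P) :
    (fun Y => torusPeriodic b (w • k) (torusMap (autMatrix b w) Y)) =ᵐ[volume]
      fun Y => (sign b w k : ℝ) * torusPeriodic b k Y := by
  have h1 : autMatrix b w * autMatrix b w⁻¹ = (1 : ℤ) • (1 : Matrix b.support b.support ℤ) := by
    rw [autMatrix_mul, mul_inv_cancel, autMatrix_one, one_smul]
  have h2 : autMatrix b w⁻¹ * autMatrix b w = 1 := by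
    rw [autMatrix_mul, inv_mul_cancel, autMatrix_one]
  refine ((bddMeas_torusPeriodic b _).comp (continuous_torusMap _).measurable).ae_eq
    ((bddMeas_torusPeriodic b k).const_mul _) fun m => ?_
  rw [mFourierCoeff_const_mul, mFourierCoeff_torusPeriodic]
  set n := Matrix.vecMul m (autMatrix b w⁻¹) with hn
  have hm : m = Matrix.vecMul n (autMatrix b w) := by
    rw [hn, Matrix.vecMul_vecMul, h2, Matrix.vecMul_one]
  have h3 : mFourierCoeff (fun Y => (torusPeriodic b (w • k) Y : ℂ)) n =
      mFourierCoeff (fun Y => (torusPeriodic b (w • k) (torusMap (autMatrix b w) Y) : ℂ)) m := by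
    rw [mFourierCoeff, mFourierCoeff, ← integral_comp_torus (continuous_torusMap (autMatrix b w))
      (torusMap_surjective one_ne_zero h1)]
    · congr 1
      ext Y
      rw [mFourier_torusMap, Matrix.neg_vecMul, ← hm]
    · exact (mFourier _).continuous.measurable.smul
        (Complex.measurable_ofReal.comp (bddMeas_torusPeriodic b _).1)
  rw [← h3, mFourierCoeff_torusPeriodic, coef_smul, ← hm]
  simp

variable [TopologicalSpace N] [IsTopologicalAddGroup N] [ContinuousSMul ℝ N] [T2Space N]

/-- The transformation formula of the periodic function. -/
lemma periodic_act (w : P.Aut) (k : Exponent P) (ν : Cell b) {y : N} (hy : y ∈ ν.1) :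
    periodic b (w • k) (act w y) = sign b w k * periodic b k y := by
  have h := eqOn_cell_of_ae b (torusPeriodic_smul_ae b w k) ν ?_ ?_ hy
  · rw [← toTorus_coord_act, ← periodic_eq, ← periodic_eq] at h
    exact h
  · intro z hz
    have h1 : ContinuousAt (fun z => periodic b (w • k) (act w z)) z :=
      ContinuousAt.comp (g := periodic b (w • k)) (continuousAt_periodic b _
        (by rw [act_mem_arrangement_iff]; exact (ν.subset hz).2))
        (continuous_linearMap b (act w).toLinearMap).continuousAt
    refine h1.continuousWithinAt.congr (fun x _ => ?_) ?_ <;>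
      rw [← toTorus_coord_act, ← periodic_eq]
  · intro z hz
    have h1 := (continuousAt_periodic b k (ν.subset hz).2).const_mul (sign b w k : ℝ)
    refine h1.continuousWithinAt.congr (fun x _ => ?_) ?_ <;> rw [← periodic_eq]

end Transformation

/-! ### Affine substitutions and the transformation formula for polynomials. -/

section Substitution

variable {ι M N : Type*} [Fintype ι] [AddCommGroup M] [Module ℝ M] [AddCommGroup N] [Module ℝ N]
  {P : RootPairing ι ℝ M N} (b : P.Base) [P.IsRootSystem]

open MvPolynomial

/-- The substitution `y ↦ w y + q` in polynomials in the coordinates, `q` having coordinates `c`. -/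
def substPoly (w : P.Aut) (c : b.support → ℤ) :
    MvPolynomial b.support ℚ →ₐ[ℚ] MvPolynomial b.support ℚ :=
  bind₁ fun i => ∑ j, C (autMatrix b w i j : ℚ) * X j + C (c i : ℚ)

lemma aeval_substPoly (w : P.Aut) {q : N} {c : b.support → ℤ} (hc : ∀ i, coord b q i = c i) (y : N)
    (p : MvPolynomial b.support ℚ) :
    aeval (coord b y) (substPoly b w c p) = aeval (coord b (act w y + q)) p := by
  rw [substPoly, aeval_bind₁]
  congr 2
  ext i
  rw [coord_add, coord_act, hc]
  simp

lemma coordC_tmul (z : ℂ) (y : N) (i : b.support) : coordC b (z ⊗ₜ[ℝ] y) i = z * coord b y i := by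
  simp [coordC, coord, mul_comm]

lemma coordC_add (y z : ℂ ⊗[ℝ] N) (i : b.support) :
    coordC b (y + z) i = coordC b y i + coordC b z i := by
  simp [coordC]

lemma coordC_act (w : P.Aut) (y : ℂ ⊗[ℝ] N) (i : b.support) :
    coordC b ((act w).toLinearMap.baseChange ℂ y) i =
      ∑ j, (autMatrix b w i j : ℂ) * coordC b y j := by
  induction y using TensorProduct.induction_on with
  | zero => simp [coordC]
  | tmul z y =>
    rw [LinearMap.baseChange_tmul, coordC_tmul, LinearEquiv.coe_coe, coord_act]
    push_cast
    simp only [coordC_tmul, Finset.mul_sum]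
    exact Finset.sum_congr rfl fun j _ => by ring
  | add y z hy hz =>
    rw [map_add, coordC_add, hy, hz, ← Finset.sum_add_distrib]
    exact Finset.sum_congr rfl fun j _ => by rw [coordC_add, mul_add]

lemma aeval_coordC_substPoly (w : P.Aut) {q : N} {c : b.support → ℤ}
    (hc : ∀ i, coord b q i = c i) (y : ℂ ⊗[ℝ] N) (p : MvPolynomial b.support ℚ) :
    aeval (coordC b y) (substPoly b w c p) =
      aeval (coordC b ((act w).toLinearMap.baseChange ℂ y + 1 ⊗ₜ[ℝ] q)) p := by
  rw [substPoly, aeval_bind₁]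
  congr 2
  ext i
  rw [coordC_add, coordC_act, coordC_tmul, hc]
  simp

lemma sign_mul_self (w : P.Aut) (k : Exponent P) : sign b w k * sign b w k = 1 := by
  rw [sign, ← Finset.prod_mul_distrib]
  refine Finset.prod_eq_one fun i _ => ?_
  rw [zpow_neg, zpow_natCast, ← mul_inv, ← mul_pow]
  simp

variable [TopologicalSpace N] [IsTopologicalAddGroup N] [ContinuousSMul ℝ N] [T2Space N] {b}

/-- The coordinates of the translation vectors. -/
lemma exists_coord_shift (w : P.Aut) (ν : Cell b) :
    ∃ c : b.support → ℤ, ∀ i, coord b (shift w ν) i = c i :=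
  (mem_corootLattice_iff b).1 (shift_mem w ν)

/-- The transformation formula as an identity of rational polynomials. -/
lemma substPoly_bernoulliPoly (w : P.Aut) (k : Exponent P) (ν : Cell b) {c : b.support → ℤ}
    (hc : ∀ i, coord b (shift w⁻¹ (w • ν)) i = c i) :
    substPoly b w⁻¹ c (bernoulliPoly b k ν) =
      C (sign b w k) * bernoulliPoly b (w • k) (w • ν) := by
  refine eq_of_eqOn_cell (w • ν) fun y hy => ?_
  rw [aeval_substPoly b w⁻¹ hc, map_mul, algHom_C,
    continues_bernoulliPoly (w • k) (w • ν) y hy]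
  have hz : act w⁻¹ y + shift w⁻¹ (w • ν) ∈ ν.1 := by
    have h := image_shift w⁻¹ (w • ν)
    rw [inv_smul_smul] at h
    exact h ▸ ⟨y, hy, rfl⟩
  -- Applying `w` to `w⁻¹ y + shift` gives `y` plus a lattice vector, which periodicity removes. The
  -- sign squares to `1` and so may change sides.
  have h1 := periodic_act b w k ν hz
  rw [map_add, act_act_inv, periodic_add b _ _ (act_mem_corootLattice b w (shift_mem _ _))] at h1
  rw [continues_bernoulliPoly k ν _ hz, h1, eq_ratCast, ← mul_assoc, ← Rat.cast_mul, sign_mul_self,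
    Rat.cast_one, one_mul]

lemma aeval_coord_bernoulliPoly (w : P.Aut) (k : Exponent P) (ν : Cell b) (y : N) :
    aeval (coord b (act w⁻¹ y + shift w⁻¹ (w • ν))) (bernoulliPoly b k ν) =
      sign b w k * aeval (coord b y) (bernoulliPoly b (w • k) (w • ν)) := by
  obtain ⟨c, hc⟩ := exists_coord_shift w⁻¹ (w • ν)
  rw [← aeval_substPoly b w⁻¹ hc, substPoly_bernoulliPoly w k ν hc, map_mul, algHom_C, eq_ratCast]

lemma aeval_coordC_bernoulliPoly (w : P.Aut) (k : Exponent P) (ν : Cell b) (y : ℂ ⊗[ℝ] N) :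
    aeval (coordC b ((act w⁻¹).toLinearMap.baseChange ℂ y + 1 ⊗ₜ[ℝ] shift w⁻¹ (w • ν)))
        (bernoulliPoly b k ν) =
      (sign b w k : ℂ) * aeval (coordC b y) (bernoulliPoly b (w • k) (w • ν)) := by
  obtain ⟨c, hc⟩ := exists_coord_shift w⁻¹ (w • ν)
  rw [← aeval_coordC_substPoly b w⁻¹ hc, substPoly_bernoulliPoly w k ν hc, map_mul, algHom_C,
    eq_ratCast]

end Substitution

/-! ### The representation on vector-valued polynomials and its orbit subspaces. -/

section Representation

variable {ι M N : Type*} [Fintype ι] [AddCommGroup M] [Module ℝ M] [AddCommGroup N] [Module ℝ N]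
  {P : RootPairing ι ℝ M N} (b : P.Base) [P.IsRootSystem]
  [TopologicalSpace N] [IsTopologicalAddGroup N] [ContinuousSMul ℝ N] [T2Space N]

/-- The representation of the automorphism group on vector-valued polynomials. -/
def polyRep : Representation ℚ P.Aut (polySpace b) where
  toFun w :=
    { toFun := fun f => ⟨fun y ν => f.1 (act w⁻¹ y + shift w⁻¹ ν) (w⁻¹ • ν), fun ν => by
        obtain ⟨p, hp⟩ := f.2 (w⁻¹ • ν)
        obtain ⟨c, hc⟩ := exists_coord_shift w⁻¹ ν
        exact ⟨substPoly b w⁻¹ c p, fun y =>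
          (hp _).trans (aeval_substPoly b w⁻¹ hc y p).symm⟩⟩
      map_add' := fun f g => rfl
      map_smul' := fun c f => rfl }
  map_one' := by
    ext f y ν
    change f.1 (act (1 : P.Aut)⁻¹ y + shift (1 : P.Aut)⁻¹ ν) ((1 : P.Aut)⁻¹ • ν) = f.1 y ν
    rw [inv_one, act_one, shift_one, add_zero, one_smul]
  map_mul' v w := by
    ext f y ν
    change f.1 (act (v * w)⁻¹ y + shift (v * w)⁻¹ ν) ((v * w)⁻¹ • ν) =
      f.1 (act w⁻¹ (act v⁻¹ y + shift v⁻¹ ν) + shift w⁻¹ (v⁻¹ • ν)) (w⁻¹ • v⁻¹ • ν)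
    -- Multiplicativity is exactly the cocycle identity for the pair `w⁻¹`, `v⁻¹`.
    rw [mul_inv_rev, act_mul, ← shift_mul, mul_smul, map_add]
    refine congrArg (fun z => f.1 z _) ?_
    abel

lemma polyRep_apply (w : P.Aut) (f : polySpace b) (y : N) (ν : Cell b) :
    (polyRep b w f).1 y ν = f.1 (act w⁻¹ y + shift w⁻¹ ν) (w⁻¹ • ν) := rfl

lemma polyRep_vecB (w : P.Aut) (k : Exponent P) (ν : Cell b) :
    polyRep b w (vecB b k ν) = sign b w k • vecB b (w • k) (w • ν) := by
  refine Subtype.ext (funext fun y => funext fun κ => ?_)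
  rw [polyRep_apply]
  have h1 : ∀ (k : Exponent P) (ν κ : Cell b) (y : N), (vecB b k ν).1 y κ =
      if κ = ν then MvPolynomial.aeval (coord b y) (bernoulliPoly b k ν) else 0 := fun _ _ _ _ => rfl
  have h2 : (sign b w k • vecB b (w • k) (w • ν)).1 y κ =
      (sign b w k : ℝ) * (vecB b (w • k) (w • ν)).1 y κ := Rat.smul_def _ _
  rw [h2, h1, h1]
  by_cases h : κ = w • ν
  · subst h
    rw [if_pos (inv_smul_smul w ν), if_pos rfl, aeval_coord_bernoulliPoly]
  · rw [if_neg h, if_neg (fun h' => h (by rw [← h', smul_inv_smul])), mul_zero]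

/-- The roots span, so an automorphism is determined by its permutation of a finite set. -/
lemma finite_aut : Finite P.Aut := by
  refine Finite.of_injective (RootPairing.Equiv.indexHom P) fun v w h => ?_
  refine RootPairing.Equiv.weightHom_injective P (LinearEquiv.toLinearMap_injective ?_)
  refine LinearMap.ext_on_range (v := P.root) RootPairing.IsRootSystem.span_root_eq_top fun i => ?_
  have hi : v • i = w • i := congrArg (fun e : ι ≃ ι => e i) h
  have := root_smul v i
  rw [hi, root_smul] at this
  exact this.symm

lemma finite_orbit (o : MulAction.orbitRel.Quotient P.Aut (Exponent P × Cell b)) :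
    o.orbit.Finite := by
  have : Finite P.Aut := finite_aut
  induction o using Quotient.inductionOn with
  | h a => exact Set.finite_range _

lemma finiteDimensional_orbitSpan
    (o : MulAction.orbitRel.Quotient P.Aut (Exponent P × Cell b)) :
    FiniteDimensional ℚ (orbitSpan b o) :=
  FiniteDimensional.span_of_finite ℚ ((finite_orbit b o).image _)

lemma polyRep_mem_orbitSpan (o : MulAction.orbitRel.Quotient P.Aut (Exponent P × Cell b))
    (w : P.Aut) {f : polySpace b} (hf : f ∈ orbitSpan b o) : polyRep b w f ∈ orbitSpan b o := by
  induction hf using Submodule.span_induction with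
  | mem f hf =>
    obtain ⟨⟨k, ν⟩, h, rfl⟩ := hf
    rw [polyRep_vecB]
    refine Submodule.smul_mem _ _ (Submodule.subset_span ⟨w • (k, ν), ?_, rfl⟩)
    rw [MulAction.orbitRel.Quotient.mem_orbit] at h ⊢
    rw [← h]
    exact Quotient.sound (MulAction.mem_orbit _ w)
  | zero => rw [map_zero]; exact zero_mem _
  | add f g _ _ hf hg => rw [map_add]; exact add_mem hf hg
  | smul c f _ hf => rw [map_smul]; exact Submodule.smul_mem _ _ hf

end Representation

/-! ### Rank one: the classical Bernoulli polynomials. -/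

section RankOne

open MeasureTheory

variable {ι M N : Type*} [Fintype ι] [AddCommGroup M] [Module ℝ M] [AddCommGroup N] [Module ℝ N]
  {P : RootPairing ι ℝ M N} {b : P.Base} [P.IsRootSystem] {i : b.support}

lemma eq_of_isPos_of_rank_one (hi : ∀ j, j = i) {j : ι} (hj : b.IsPos j) : j = i := by
  have h1 : b.toWeightBasis.repr (P.root j) i • P.root i = P.root j := by
    have h := b.toWeightBasis.sum_repr (P.root j)
    rw [Fintype.sum_eq_single i (fun l hl => (hl (hi l)).elim)] at h
    simpa using h
  have : IsAddTorsionFree M := .of_isTorsionFree ℝ M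
  have : IsAddTorsionFree N := .of_isTorsionFree ℝ N
  rcases b.eq_one_or_neg_one_of_mem_support_of_smul_mem i i.2 _ ⟨j, h1.symm⟩ with h | h
  · rw [h, one_smul] at h1
    exact P.root.injective h1.symm
  · rw [h, neg_one_smul] at h1
    have h2 : j = P.reflectionPerm i i := P.root.injective (by
      rw [← h1, P.root_reflectionPerm, P.reflection_apply_self])
    rw [h2, isPos_reflectionPerm_self] at hj
    exact (hj (b.isPos_of_mem_support i.2)).elim

lemma periodic_of_rank_one (hi : ∀ j, j = i) (k : Exponent P) (y : N) :
    periodic b k y = bernoulliFun (k.1 i) (Int.fract (coord b y i)) := by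
  have : IsEmpty {j : ι // b.IsPos j ∧ j ∉ b.support} :=
    ⟨fun j => j.2.2 (eq_of_isPos_of_rank_one hi j.2.1 ▸ i.2)⟩
  have h1 : ∀ f : b.support → ℝ, ∏ j, f j = f i := fun f =>
    Fintype.prod_eq_single i fun l hl => (hl (hi l)).elim
  have h2 : Set.Icc (0 : {j : ι // b.IsPos j ∧ j ∉ b.support} → ℝ) 1 = Set.univ :=
    Set.eq_univ_of_forall fun x => ⟨fun j => isEmptyElim j, fun j => isEmptyElim j⟩
  -- There are no nonsimple positive roots; the integral is over a point, of mass `1`.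
  have h3 : volume.real (Set.univ : Set ({j : ι // b.IsPos j ∧ j ∉ b.support} → ℝ)) = 1 := by
    rw [measureReal_def, volume_pi, Measure.pi_univ, Finset.univ_eq_empty, Finset.prod_empty,
      ENNReal.toReal_one]
  simp only [periodic, h1, h2, Measure.restrict_univ, Finset.univ_eq_empty, Finset.prod_empty,
    Finset.sum_empty, one_mul, sub_zero, integral_const, h3, one_smul]

variable [TopologicalSpace N] [IsTopologicalAddGroup N] [ContinuousSMul ℝ N] [T2Space N]

lemma bernoulliPoly_of_rank_one (hi : ∀ j, j = i) (k : Exponent P) (ν : Cell b) :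
    bernoulliPoly b k ν = Polynomial.aeval (MvPolynomial.X i) (Polynomial.bernoulli (k.1 i)) := by
  refine (eq_bernoulliPoly fun y hy => ?_).symm
  have h := coord_mem_Ioo b (ν.subset hy) i
  rw [aeval_bernoulli, MvPolynomial.aeval_X, periodic_of_rank_one hi,
    Int.fract_eq_self.2 ⟨h.1.le, h.2⟩]

/-- Here `R` is empty, so the arrangement is the coroot lattice and misses the open interval; hence
there is only one cell. -/
lemma parallelotope_diff_of_rank_one (hi : ∀ j, j = i) :
    parallelotope b \ arrangement b = coord b ⁻¹' Set.pi Set.univ fun _ => Set.Ioo 0 1 := by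
  ext y
  refine ⟨fun hy j _ => coord_mem_Ioo b hy j, fun hy =>
    ⟨fun j => ⟨(hy j trivial).1.le, (hy j trivial).2.le⟩, ?_⟩⟩
  rintro ⟨R, -, hR, q, hq, hyq⟩
  have hcard : b.support.card = 1 :=
    Finset.card_eq_one.2 ⟨i, Finset.eq_singleton_iff_unique_mem.2
      ⟨i.2, fun j hj => congrArg Subtype.val (hi ⟨j, hj⟩)⟩⟩
  have hR0 : R = ∅ := Finset.card_eq_zero.1 (by omega)
  rw [hR0, Finset.coe_empty, Set.image_empty, Submodule.span_empty, Submodule.mem_bot,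
    sub_eq_zero] at hyq
  subst hyq
  obtain ⟨c, hc⟩ := (mem_corootLattice_iff b).1 hq
  have h := hy i trivial
  rw [hc] at h
  have h1 : 0 < c i := by exact_mod_cast h.1
  have h2 : c i < 1 := by exact_mod_cast h.2
  omega

lemma cell_eq_of_rank_one (hi : ∀ j, j = i) (ν κ : Cell b) : ν = κ := by
  have hpre : IsPreconnected (parallelotope b \ arrangement b) := by
    rw [parallelotope_diff_of_rank_one hi]
    exact (coordHomeo b).isPreconnected_preimage.2
      (convex_pi fun _ _ => convex_Ioo 0 1).isPreconnected
  have h : ∀ ν : Cell b, ν.1 = parallelotope b \ arrangement b := by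
    rintro ⟨D, y, hy, rfl⟩
    exact hpre.connectedComponentIn hy
  exact Subtype.ext ((h ν).trans (h κ).symm)

lemma act_reflection_of_rank_one (hi : ∀ j, j = i) (y : N) :
    act (RootPairing.Equiv.reflection P i) y = -y := by
  have h1 : y = coord b y i • P.coroot i := by
    apply coord_injective b
    ext j
    rw [hi j, coord_smul, coord_simple, if_pos rfl, mul_one]
  have h2 : RootPairing.Equiv.reflection P (i : ι) • (i : ι) = P.reflectionPerm i i := rfl
  rw [h1, map_smul, act_coroot, h2, coroot_reflectionPerm_self, smul_neg]

lemma shift_reflection_of_rank_one (hi : ∀ j, j = i) (ν : Cell b) :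
    shift (RootPairing.Equiv.reflection P i) ν = P.coroot i := by
  obtain ⟨y, hy⟩ := ν.nonempty
  have hq := coroot_mem_corootLattice b (i : ι)
  have hy' : act (RootPairing.Equiv.reflection P i) y + P.coroot i ∈
      parallelotope b \ arrangement b := by
    refine ⟨fun j => ?_, move_notMem_arrangement hq (ν.subset hy).2⟩
    have h := coord_mem_Ioo b (ν.subset hy) i
    rw [hi j, act_reflection_of_rank_one hi, neg_add_eq_sub, coord_sub, coord_simple, if_pos rfl]
    constructor <;> linarith
  exact ((shift_unique _ ν _ hq _ (image_move_eq hq hy hy')).1).symm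

end RankOne

end RootBernoulli

end

theorem mainTheorem10 {ι M N : Type*} [Fintype ι] [AddCommGroup M] [Module ℝ M]
    [AddCommGroup N] [Module ℝ N] [TopologicalSpace N] [IsTopologicalAddGroup N]
    [ContinuousSMul ℝ N] [T2Space N] (P : RootPairing ι ℝ M N) [P.IsRootSystem]
    [P.IsCrystallographic] [P.IsReduced] (b : P.Base) :
    -- the polynomials `B_k^(ν)` are well defined
    (∀ (k : Exponent P) (ν : Cell b), Continues b k ν (bernoulliPoly b k ν) ∧
      ∀ p, Continues b k ν p → p = bernoulliPoly b k ν) ∧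
    -- the action on components, twisted by translations by the coroot lattice
    ∃ (_ : MulAction P.Aut (Cell b)) (q : P.Aut → Cell b → N),
      (∀ w ν, q w ν ∈ corootLattice b ∧ (fun y => act w y + q w ν) '' ν.1 = (w • ν).1) ∧
      (∀ w ν, ∀ q' ∈ corootLattice b, ∀ κ : Cell b,
        (fun y => act w y + q') '' ν.1 = κ.1 → q' = q w ν ∧ κ = w • ν) ∧
      (∀ v w ν, q v (w • ν) + act v (q w ν) = q (v * w) ν) ∧
      -- the transformation formula for the polynomials, on the complexified space
      (∀ (w : P.Aut) (k : Exponent P) (ν : Cell b) (y : ℂ ⊗[ℝ] N),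
        MvPolynomial.aeval (coordC b ((act w⁻¹).toLinearMap.baseChange ℂ y +
            1 ⊗ₜ[ℝ] q w⁻¹ (w • ν))) (bernoulliPoly b k ν) =
          (sign b w k : ℂ) *
            MvPolynomial.aeval (coordC b y) (bernoulliPoly b (w • k) (w • ν))) ∧
      -- the representation on vector-valued polynomials
      ∃ φ : Representation ℚ P.Aut (polySpace b),
        (∀ w f y ν, (φ w f).1 y ν = f.1 (act w⁻¹ y + q w⁻¹ ν) (w⁻¹ • ν)) ∧
        (∀ w k ν, φ w (vecB b k ν) = sign b w k • vecB b (w • k) (w • ν)) ∧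
        (∀ o : MulAction.orbitRel.Quotient P.Aut (Exponent P × Cell b),
          FiniteDimensional ℚ (orbitSpan b o) ∧
            ∀ w, ∀ f ∈ orbitSpan b o, φ w f ∈ orbitSpan b o) ∧
        -- rank one: the classical Bernoulli polynomials and the substitution `y ↦ 1 - y`
        (∀ i : b.support, (∀ j, j = i) →
          (∀ k ν, bernoulliPoly b k ν =
            Polynomial.aeval (MvPolynomial.X i) (Polynomial.bernoulli (k.1 i))) ∧
          ∀ f y ν, (φ (RootPairing.Equiv.reflection P i) f).1 y ν =
            f.1 (P.coroot i - y) ν) := by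
  refine ⟨fun k ν => ⟨continues_bernoulliPoly k ν, fun p hp => eq_bernoulliPoly hp⟩,
    cellAction b, shift, fun w ν => ⟨shift_mem w ν, image_shift w ν⟩, shift_unique, shift_mul,
    aeval_coordC_bernoulliPoly, polyRep b, fun w f y ν => rfl, polyRep_vecB b, fun o =>
    ⟨finiteDimensional_orbitSpan b o, fun w f hf => polyRep_mem_orbitSpan b o w hf⟩,
    fun i hi => ⟨bernoulliPoly_of_rank_one hi, fun f y ν => ?_⟩⟩
  rw [polyRep_apply, RootPairing.Equiv.reflection_inv, act_reflection_of_rank_one hi,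
    shift_reflection_of_rank_one hi, neg_add_eq_sub]
  exact congrArg _ (cell_eq_of_rank_one hi _ ν)
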